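/- For every choice of constants $c_0, c_1, C > 0$ there is a constant $C' > 0$, depending only on $c_0, c_1, C$, such that the following holds. Let $d \ge 1$, let $K \subset \mathbb{R}^d$ be a compact convex set with non-empty interior, let $F$ be a self-concordant barrier of $K$, that is, a convex, thrice continuously differentiable function on $\operatorname{int}(K)$ that tends to $\infty$ along every sequence in $\operatorname{int}(K)$ converging to a point outside $\operatorname{int}(K)$ and satisfies, for some positive integer $\nu$ and all $x \in \operatorname{int}(K)$, $h \in \mathbb{R}^d$, $$D^3F(x)[h,h,h] \le 2\,(D^2F(x)[h,h])^{3/2}, \qquad |DF(x)[h]|^2 \le \nu\, D^2F(x)[h,h],$$ and let $s : K \to \mathbb{R}$ be convex. For $x \in \operatorname{int}(K)$ write $\|v\|_x = (D^2F(x)[v,v])^{1/2}$, let $\rho(x,y)$ be the infimum of the Riemannian lengths $\int_0^1 \|\gamma'(t)\|_{\gamma(t)}\,dt$ of the paths $\gamma$ in $\operatorname{int}(K)$ from $x$ to $y$ (with $\rho(x,y) = \infty$ if there is none), and let $G^r_x$ be the Gaussian probability density on $\mathbb{R}^d$ with $$G^r_x(y) \propto \exp\left(-\frac{d\,\|x-y\|_x^2}{r^2}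 + V(x)\right), \qquad V(x) = \tfrac12 \ln\det D^2F(x).$$ Let the step size $r > 0$ satisfy $r \le \min\{1/d, r^*\}$, where, for some $g \in \mathbb{R}^d$, $$r^* \le \sup\left\{ t : |s(z) - s(w) - \langle g, z-w\rangle| < c_0 \text{ for all } z \in \operatorname{int}(K),\ w \in K \text{ with } \|z-w\|_z \le c_1 t \right\}.$$ Let $P_x$ be the one-step transition law at $x$ of the Dikin walk: with probability $1/2$ stay at $x$; with probability $1/2$ draw $z$ from $G^r_x$, stay at $x$ if $z \notin K$, and if $z \in K$ move to $z$ with probability $\min\left(1, \frac{G^r_z(x)\, e^{s(x)}}{G^r_x(z)\, e^{s(z)}}\right)$ and stay at $x$ otherwise. If $x, y \in K$ and $\rho(x,y) \le \dfrac{r}{C\sqrt d}$, then $$d_{TV}(P_x, P_y) \le 1 - \frac{1}{C'},$$ where $d_{TV}(P,Q) = \sup_B |P(B) - Q(B)|$ over the Borel sets $B$. -/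

import Mathlib

open MeasureTheory Filter Topology
open scoped ENNReal

noncomputable section

namespace DikinWalk

/-- Shorthand for `ℝ^d` with its Euclidean structure and Lebesgue measure. -/
abbrev Eu (d : ℕ) : Type := EuclideanSpace ℝ (Fin d)

variable {d : ℕ}

/-- The local inner product `⟨v, w⟩_x = D²F(x)[v, w]`. -/
def localInner (F : Eu d → ℝ) (x v w : Eu d) : ℝ := iteratedFDeriv ℝ 2 F x ![v, w]

/-- The local norm `‖v‖_x = (D²F(x)[v, v])^{1/2}`. -/
def localNorm (F : Eu d → ℝ) (x v : Eu d) : ℝ := Real.sqrt (localInner F x v v)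

/-- `F` is a (regular) self-concordant barrier of `K`, with the barrier inequality holding with
the positive integer `ν`. Only the values of `F` on the interior of `K` matter. -/
structure IsSelfConcordantBarrier (K : Set (Eu d)) (F : Eu d → ℝ) (ν : ℕ) : Prop where
  convex : ConvexOn ℝ (interior K) F
  smooth : ContDiffOn ℝ 3 F (interior K)
  barrier : ∀ u : ℕ → Eu d, (∀ i, u i ∈ interior K) → ∀ x, x ∉ interior K →
    Tendsto u atTop (𝓝 x) → Tendsto (fun i => F (u i)) atTop atTop
  third_le : ∀ x ∈ interior K, ∀ h : Eu d,
    iteratedFDeriv ℝ 3 F x ![h, h, h] ≤ 2 * (iteratedFDeriv ℝ 2 F x ![h, h]) ^ (3 / 2 : ℝ)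
  param_pos : 0 < ν
  first_le : ∀ x ∈ interior K, ∀ h : Eu d,
    |fderiv ℝ F x h| ^ 2 ≤ (ν : ℝ) * iteratedFDeriv ℝ 2 F x ![h, h]

/-- The Riemannian length `∫ ‖γ'(t)‖_{γ(t)} dt` of a path parametrized by `[0, 1]`. -/
def pathLength (F : Eu d → ℝ) (γ : ℝ → Eu d) : ℝ≥0∞ :=
  ∫⁻ t in Set.Icc (0 : ℝ) 1,
    ENNReal.ofReal (localNorm F (γ t) (derivWithin γ (Set.Icc (0 : ℝ) 1) t))

/-- The Riemannian distance `ρ(x, y)` on the interior of `K` (where the metric lives): the infimum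
of the lengths of the `C¹` paths from `x` to `y` inside it. The value is `∞` if there is no such
path, in particular if `x` or `y` is a boundary point of `K`. -/
def riemDist (K : Set (Eu d)) (F : Eu d → ℝ) (x y : Eu d) : ℝ≥0∞ :=
  ⨅ (γ : ℝ → Eu d) (_ : ContDiffOn ℝ 1 γ (Set.Icc (0 : ℝ) 1))
    (_ : ∀ t ∈ Set.Icc (0 : ℝ) 1, γ t ∈ interior K) (_ : γ 0 = x) (_ : γ 1 = y), pathLength F γ

/-- The matrix of `D²F(x)` in the standard basis. -/
def hessMatrix (F : Eu d → ℝ) (x : Eu d) : Matrix (Fin d) (Fin d) ℝ :=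
  Matrix.of fun i j =>
    localInner F x (EuclideanSpace.basisFun (Fin d) ℝ i) (EuclideanSpace.basisFun (Fin d) ℝ j)

/-- `V(x) = (1/2) ln det D²F(x)`. -/
def logVol (F : Eu d → ℝ) (x : Eu d) : ℝ := 1 / 2 * Real.log (hessMatrix F x).det

/-- The unnormalized Gaussian weight `exp(-d ‖x - y‖_x² / r² + V(x))`. -/
def gaussWeight (F : Eu d → ℝ) (r : ℝ) (x y : Eu d) : ℝ :=
  Real.exp (-((d : ℝ) * localNorm F x (x - y) ^ 2 / r ^ 2) + logVol F x)

/-- The Gaussian probability density `G^r_x(y)`, i.e. the weight normalized to have integral one. -/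
def gaussDensity (F : Eu d → ℝ) (r : ℝ) (x y : Eu d) : ℝ :=
  gaussWeight F r x y / ∫ u : Eu d, gaussWeight F r x u

/-- The probability measure with density `G^r_x`. -/
def proposal (F : Eu d → ℝ) (r : ℝ) (x : Eu d) : Measure (Eu d) :=
  volume.withDensity fun z => ENNReal.ofReal (gaussDensity F r x z)

/-- The probability of accepting the proposal `z` at the point `x`, for the target `exp(-s)`. -/
def acceptProb (F s : Eu d → ℝ) (r : ℝ) (x z : Eu d) : ℝ :=
  min 1 (gaussDensity F r z x * Real.exp (s x) / (gaussDensity F r x z * Real.exp (s z)))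

/-- The one-step law `P_x` of the Dikin walk at `x`. With probability `1/2` stay at `x`; with
probability `1/2` draw `z` from `G^r_x`, stay at `x` if `z ∉ K`, and if `z ∈ K` move to `z` with the
acceptance probability and stay at `x` otherwise. The boundary of `K`, on which `G^r_z` has no
meaning, is Lebesgue-null and so plays no role. -/
def kernel (K : Set (Eu d)) (F s : Eu d → ℝ) (r : ℝ) (x : Eu d) : Measure (Eu d) :=
  (1 / 2 : ℝ≥0∞) • Measure.dirac x +
  (1 / 2 : ℝ≥0∞) •
    (((proposal F r x).restrict K).withDensity
        (fun z => ENNReal.ofReal (acceptProb F s r x z)) +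
      (proposal F r x Kᶜ +
        ∫⁻ z in K, ENNReal.ofReal (1 - acceptProb F s r x z) ∂(proposal F r x)) •
          Measure.dirac x)

/-- Total variation distance `sup_B |P(B) - Q(B)|` of two probability measures. -/
def tvDist (P Q : Measure (Eu d)) : ℝ :=
  ⨆ B : {B : Set (Eu d) // MeasurableSet B}, |P.real B.1 - Q.real B.1|

/-- The radii `t` such that `s` is within `c₀` of being linear with slope `g` on pairs of points at
local distance at most `c₁ t`. The local norm at `z` exists for `z` in the interior only. -/
def goodRadii (K : Set (Eu d)) (F s : Eu d → ℝ) (c₀ c₁ : ℝ) (g : Eu d) : Set ℝ :=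
  {t : ℝ | ∀ z ∈ interior K, ∀ w ∈ K, localNorm F z (z - w) ≤ c₁ * t →
    |s z - s w - inner ℝ g (z - w)| < c₀}

/-- The general step size condition with constants `c₀, c₁`: the step size satisfies
`r ≤ min {1/d, r*}` for some `r*` bounded, for a suitable slope `g`, by the supremum (possibly `∞`)
of the good radii. -/
def IsValidStepSize (K : Set (Eu d)) (F s : Eu d → ℝ) (c₀ c₁ r : ℝ) : Prop :=
  0 < r ∧ ∃ rstar : ℝ, r ≤ min (1 / (d : ℝ)) rstar ∧
    ∃ g : Eu d, (rstar : EReal) ≤ ⨆ t ∈ goodRadii K F s c₀ c₁ g, (t : EReal)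

end DikinWalk

end

/-!
The transition laws at nearby points overlap because, on a set of proposals carrying a fixed part of
the mass, the two proposal densities and the acceptance probabilities agree up to constant factors.

* *Self-concordance.* Polarization turns the diagonal inequality for `D³F` into
  `|D³F(x)[v, w, w]| ≤ 6 ‖v‖_x ‖w‖_x²` (`IsSelfConcordantBarrier.abs_third_le`). Grönwall then shows
  that squared local norms change by a factor of at most `e^{6L}` along a path of length `L`
  (`IsInteriorPath.hessQuad_le`), so that displacement is bounded by length
  (`IsInteriorPath.localNorm_sub_le`). Along a straight segment, the same idea together with the
  barrier property gives the Dikin ellipsoid (`IsSelfConcordantBarrier.add_smul_mem_interior`) and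
  hence, `K` being bounded, the definiteness of the Hessian. Here `L = O(r / √d)` for the path from
  `x` to `y`, and `L = O(r)` for the segment from `x` to a typical proposal. Since `r ≤ 1 / d`, the
  product `L d` is bounded in both cases.

* *Densities.* The factor `exp (V(x))` of the weight cancels in the normalization, and normalizing
  constants at points with comparable Hessians are compared by rescaling the variable of integration
  (`IsSelfConcordantBarrier.exp_mul_gaussConst_le`), so that no determinant has to be evaluated. A
  factor `e^{O(L)}` between the Hessians changes the logarithm of a density by `O(L d) = O(1)` at
  proposals at local distance `O(r)`. What remains of `‖z - y‖² - ‖z - x‖²` is a linear functional of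
  `z - x`, of bounded variance under the Gaussian after multiplication by `d / r²`.

* *The function `s`.* A path of length `O(r)` is cut into boundedly many pieces on each of which `s`
  is linear with slope `g` up to `c₀` (`IsInteriorPath.abs_sub_inner_le`), so that `s` is linear with
  slope `g` up to a constant. On a half-space the linear part has the favourable sign; if `x` is the
  one of the two points at which `⟨g, ·⟩` is smaller, the half-space `⟨g, z - x⟩ ≤ 0` serves both.

Exponential moments show that the proposals satisfying the three requirements (length, linear
functional, half-space) have mass at least `1 / 4` under the Gaussian at `x`. In low dimension the
set is shrunk by a factor `θ` so as to fit into the Dikin ellipsoid, which costs the factor `θ ^ d`,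
bounded below (`IsSelfConcordantBarrier.le_setIntegral_goodSet`). On this set both acceptance
probabilities are bounded below and the density at `y` is at least a multiple of the one at `x`, so
the two laws have a common part of mass bounded below (`tvDist_kernel_le_of_inner_nonneg`).
-/

noncomputable section

namespace DikinWalk

variable {d : ℕ}

/-! ### The Hessian and the third derivative -/

section Hessian

variable {K : Set (Eu d)} {F : Eu d → ℝ} {ν : ℕ} {x : Eu d}

lemma localInner_eq (F : Eu d → ℝ) (x v w : Eu d) :
    localInner F x v w = fderiv ℝ (fderiv ℝ F) x v w := by
  simp [localInner, iteratedFDeriv_two_apply]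

/-- The local inner product at `x` as a bilinear form. -/
def hessForm (F : Eu d → ℝ) (x : Eu d) : LinearMap.BilinForm ℝ (Eu d) :=
  LinearMap.mk₂ ℝ (localInner F x) (by simp [localInner_eq]) (by simp [localInner_eq])
    (by simp [localInner_eq]) (by simp [localInner_eq])

/-- The squared local norm `‖v‖_x² = D²F(x)[v, v]`. -/
def hessQuad (F : Eu d → ℝ) (x v : Eu d) : ℝ := hessForm F x v v

lemma hessQuad_eq (F : Eu d → ℝ) (x v : Eu d) :
    hessQuad F x v = fderiv ℝ (fderiv ℝ F) x v v := localInner_eq F x v v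

lemma localNorm_eq (F : Eu d → ℝ) (x v : Eu d) : localNorm F x v = √(hessQuad F x v) := rfl

lemma localNorm_nonneg (F : Eu d → ℝ) (x v : Eu d) : 0 ≤ localNorm F x v := Real.sqrt_nonneg _

lemma hessQuad_smul (F : Eu d → ℝ) (x : Eu d) (c : ℝ) (v : Eu d) :
    hessQuad F x (c • v) = c ^ 2 * hessQuad F x v := by
  simp [hessQuad]; ring

lemma hessQuad_neg (F : Eu d → ℝ) (x v : Eu d) : hessQuad F x (-v) = hessQuad F x v := by
  simp [hessQuad]

lemma hessQuad_sub_comm (F : Eu d → ℝ) (x v w : Eu d) :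
    hessQuad F x (v - w) = hessQuad F x (w - v) := by
  rw [← hessQuad_neg, neg_sub]

lemma continuous_hessQuad (F : Eu d → ℝ) (x : Eu d) : Continuous (hessQuad F x) := by
  have : hessQuad F x = fun v => fderiv ℝ (fderiv ℝ F) x v v := funext (hessQuad_eq F x)
  rw [this]; fun_prop

/-- The third derivative `D³F(x)[a, b, c]`, as an iterated Fréchet derivative. -/
def third (F : Eu d → ℝ) (x a b c : Eu d) : ℝ := fderiv ℝ (fderiv ℝ (fderiv ℝ F)) x a b c

lemma iteratedFDeriv_three (F : Eu d → ℝ) (x a b c : Eu d) :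
    iteratedFDeriv ℝ 3 F x ![a, b, c] = third F x a b c := by
  rw [iteratedFDeriv_succ_apply_right, iteratedFDeriv_two_apply]
  simp [Fin.init, third]

namespace IsSelfConcordantBarrier

lemma contDiffAt (hF : IsSelfConcordantBarrier K F ν) (hx : x ∈ interior K) :
    ContDiffAt ℝ 3 F x :=
  (hF.smooth x hx).contDiffAt (isOpen_interior.mem_nhds hx)

lemma hasFDerivAt_hess (hF : IsSelfConcordantBarrier K F ν) (hx : x ∈ interior K) :
    HasFDerivAt (fderiv ℝ (fderiv ℝ F)) (fderiv ℝ (fderiv ℝ (fderiv ℝ F)) x) x := by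
  have h1 : ContDiffAt ℝ 2 (fderiv ℝ F) x :=
    (hF.contDiffAt hx).fderiv_right (by norm_num)
  have h2 : ContDiffAt ℝ 1 (fderiv ℝ (fderiv ℝ F)) x := h1.fderiv_right (by norm_num)
  exact (h2.differentiableAt (by norm_num)).hasFDerivAt

lemma hess_symm (hF : IsSelfConcordantBarrier K F ν) (hx : x ∈ interior K) (v w : Eu d) :
    fderiv ℝ (fderiv ℝ F) x v w = fderiv ℝ (fderiv ℝ F) x w v :=
  ((hF.contDiffAt hx).isSymmSndFDerivAt (by simp; norm_num)).eq v w

lemma hessForm_symm (hF : IsSelfConcordantBarrier K F ν) (hx : x ∈ interior K) (v w : Eu d) :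
    hessForm F x v w = hessForm F x w v := by
  simpa [hessForm, localInner_eq] using hF.hess_symm hx v w

lemma third_symm_left (hF : IsSelfConcordantBarrier K F ν) (hx : x ∈ interior K)
    (a b c : Eu d) : third F x a b c = third F x b a c := by
  have h1 : ContDiffAt ℝ 2 (fderiv ℝ F) x :=
    (hF.contDiffAt hx).fderiv_right (by norm_num)
  exact DFunLike.congr_fun ((h1.isSymmSndFDerivAt (by simp)).eq a b) c

lemma third_symm_right (hF : IsSelfConcordantBarrier K F ν) (hx : x ∈ interior K)
    (a b c : Eu d) : third F x a b c = third F x a c b := by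
  have key := fun b c : Eu d =>
    ((hF.hasFDerivAt_hess hx).clm_apply (hasFDerivAt_const b x)).clm_apply (hasFDerivAt_const c x)
  have hev : (fun y => fderiv ℝ (fderiv ℝ F) y b c) =ᶠ[𝓝 x]
      fun y => fderiv ℝ (fderiv ℝ F) y c b := by
    filter_upwards [isOpen_interior.mem_nhds hx] with y hy using hF.hess_symm hy b c
  have := ((key b c).congr_of_eventuallyEq hev.symm).unique (key c b)
  simpa [third] using DFunLike.congr_fun this a

/-- The Hessian is positive semidefinite: it dominates the square of the first derivative. -/
lemma hessQuad_nonneg (hF : IsSelfConcordantBarrier K F ν) (hx : x ∈ interior K) (v : Eu d) :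
    0 ≤ hessQuad F x v := by
  have h := hF.first_le x hx v
  have hν : (0 : ℝ) < ν := by exact_mod_cast hF.param_pos
  exact nonneg_of_mul_nonneg_right (a := (ν : ℝ)) ((sq_nonneg _).trans h) hν

lemma sq_localNorm (hF : IsSelfConcordantBarrier K F ν) (hx : x ∈ interior K) (v : Eu d) :
    localNorm F x v ^ 2 = hessQuad F x v :=
  Real.sq_sqrt (hF.hessQuad_nonneg hx v)

lemma hessQuad_add (hF : IsSelfConcordantBarrier K F ν) (hx : x ∈ interior K) (v w : Eu d) :
    hessQuad F x (v + w) = hessQuad F x v + 2 * hessForm F x v w + hessQuad F x w := by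
  simp only [hessQuad, map_add, LinearMap.add_apply, hF.hessForm_symm hx w v]; ring

lemma hessQuad_sub (hF : IsSelfConcordantBarrier K F ν) (hx : x ∈ interior K) (v w : Eu d) :
    hessQuad F x (v - w) = hessQuad F x v - 2 * hessForm F x v w + hessQuad F x w := by
  simp only [hessQuad, map_sub, LinearMap.sub_apply, hF.hessForm_symm hx w v]; ring

lemma hessQuad_add_le (hF : IsSelfConcordantBarrier K F ν) (hx : x ∈ interior K) (v w : Eu d) :
    hessQuad F x (v + w) ≤ 2 * hessQuad F x v + 2 * hessQuad F x w := by
  linarith [hF.hessQuad_nonneg hx (v - w), hF.hessQuad_add hx v w, hF.hessQuad_sub hx v w]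

lemma hessQuad_sub_le (hF : IsSelfConcordantBarrier K F ν) (hx : x ∈ interior K) (v w : Eu d) :
    hessQuad F x (v - w) ≤ 2 * hessQuad F x v + 2 * hessQuad F x w := by
  linarith [hF.hessQuad_nonneg hx (v + w), hF.hessQuad_add hx v w, hF.hessQuad_sub hx v w]

/-- Cauchy-Schwarz for the local inner product. -/
lemma abs_hessForm_le (hF : IsSelfConcordantBarrier K F ν) (hx : x ∈ interior K) (v w : Eu d) :
    |hessForm F x v w| ≤ localNorm F x v * localNorm F x w := by
  have h := LinearMap.BilinForm.apply_mul_apply_le_of_forall_zero_le (hessForm F x)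
    (hF.hessQuad_nonneg hx) v w
  rw [← hF.hessForm_symm hx v w] at h
  rw [localNorm_eq, localNorm_eq, ← Real.sqrt_mul (hF.hessQuad_nonneg hx v)]
  exact Real.abs_le_sqrt (by rw [sq]; exact h)

lemma abs_third_diag_le (hF : IsSelfConcordantBarrier K F ν) (hx : x ∈ interior K) (h : Eu d) :
    |third F x h h h| ≤ 2 * localNorm F x h ^ 3 := by
  have key : ∀ h : Eu d, third F x h h h ≤ 2 * localNorm F x h ^ 3 := by
    intro h
    have h1 := hF.third_le x hx h
    rw [iteratedFDeriv_three] at h1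
    refine h1.trans_eq ?_
    have h0 : 0 ≤ hessQuad F x h := hF.hessQuad_nonneg hx h
    change 2 * hessQuad F x h ^ (3 / 2 : ℝ) = _
    rw [localNorm_eq, Real.sqrt_eq_rpow, ← Real.rpow_natCast, ← Real.rpow_mul h0]
    norm_num
  rw [abs_le]
  refine ⟨?_, key h⟩
  have h2 := key (-h)
  have h3 : localNorm F x (-h) = localNorm F x h := congrArg Real.sqrt (hessQuad_neg F x h)
  rw [h3] at h2
  have h4 : third F x (-h) (-h) (-h) = - third F x h h h := by simp [third]
  linarith

lemma abs_third_le_six (hF : IsSelfConcordantBarrier K F ν) (hx : x ∈ interior K) {v w : Eu d}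
    (hv : hessQuad F x v ≤ 1) (hw : hessQuad F x w ≤ 1) : |third F x v w w| ≤ 6 := by
  have e1 : third F x w v w = third F x v w w := hF.third_symm_left hx _ _ _
  have e2 : third F x w w v = third F x v w w := by rw [hF.third_symm_right hx, e1]
  have e3 : third F x v w v = third F x w v v := hF.third_symm_left hx _ _ _
  have e4 : third F x v v w = third F x w v v := by rw [hF.third_symm_right hx, e3]
  -- The cubic form `f` satisfies `f (v + w) + f (v - w) = 2 f v + 6 D³F[v, w, w]`.
  have pol : third F x (v + w) (v + w) (v + w) + third F x (v - w) (v - w) (v - w)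
      = 2 * third F x v v v + 6 * third F x v w w := by
    have ha : third F x (v + w) (v + w) (v + w) = third F x v v v + third F x v v w
        + third F x v w v + third F x v w w + third F x w v v + third F x w v w
        + third F x w w v + third F x w w w := by
      simp only [third, map_add, add_apply]; ring
    have hb : third F x (v - w) (v - w) (v - w) = third F x v v v - third F x v v w
        - third F x v w v + third F x v w w - third F x w v v + third F x w v w
        + third F x w w v - third F x w w w := by
      simp only [third, map_sub, sub_apply]; ring
    rw [ha, hb, e1, e2]; ring
  have cube : ∀ {u : Eu d}, hessQuad F x u ≤ 4 → |third F x u u u| ≤ 16 := by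
    intro u hu
    have h0 : 0 ≤ localNorm F x u := localNorm_nonneg F x _
    have h1 : localNorm F x u ≤ 2 := by
      rw [localNorm_eq, Real.sqrt_le_left (by norm_num)]; norm_num; exact hu
    have h2 : localNorm F x u ^ 3 ≤ 2 ^ 3 := pow_le_pow_left₀ h0 h1 3
    linarith [hF.abs_third_diag_le hx u]
  have c1 := abs_le.1 (cube ((hF.hessQuad_add_le hx v w).trans (by linarith)))
  have c2 := abs_le.1 (cube ((hF.hessQuad_sub_le hx v w).trans (by linarith)))
  have c3 : |third F x v v v| ≤ 2 := by
    have h0 : 0 ≤ localNorm F x v := localNorm_nonneg F x _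
    have h1 : localNorm F x v ≤ 1 := by
      rw [localNorm_eq, Real.sqrt_le_left (by norm_num)]; norm_num; exact hv
    have h2 : localNorm F x v ^ 3 ≤ 1 ^ 3 := pow_le_pow_left₀ h0 h1 3
    linarith [hF.abs_third_diag_le hx v]
  have c4 := abs_le.1 c3
  rw [abs_le]; constructor <;> linarith [c1.1, c1.2, c2.1, c2.2, c4.1, c4.2]

/-- The diagonal self-concordance inequality controls the mixed third derivatives, with a constant
that is not optimal (the optimal one is `2`), which suffices here. -/
lemma abs_third_le (hF : IsSelfConcordantBarrier K F ν) (hx : x ∈ interior K) (v w : Eu d) :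
    |third F x v w w| ≤ 6 * localNorm F x v * hessQuad F x w := by
  have key : ∀ ε > 0, |third F x v w w| ≤
      6 * (localNorm F x v + ε) * (localNorm F x w + ε) ^ 2 := by
    intro ε hε
    have hn : ∀ u : Eu d, 0 < localNorm F x u + ε := fun u =>
      add_pos_of_nonneg_of_pos (localNorm_nonneg F x _) hε
    have hq : ∀ u : Eu d, hessQuad F x ((localNorm F x u + ε)⁻¹ • u) ≤ 1 := by
      intro u
      rw [hessQuad_smul, ← hF.sq_localNorm hx, ← mul_pow]
      apply pow_le_one₀ (mul_nonneg (inv_pos.2 (hn u)).le (localNorm_nonneg F x _))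
      rw [inv_mul_le_one₀ (hn u)]; linarith
    have h := hF.abs_third_le_six hx (hq v) (hq w)
    have e : third F x v w w = (localNorm F x v + ε) * (localNorm F x w + ε) ^ 2 *
        third F x ((localNorm F x v + ε)⁻¹ • v) ((localNorm F x w + ε)⁻¹ • w)
          ((localNorm F x w + ε)⁻¹ • w) := by
      simp only [third, map_smul, smul_apply, smul_eq_mul]
      have := (hn v).ne'; have := (hn w).ne'
      field_simp
    have hp : 0 ≤ (localNorm F x v + ε) * (localNorm F x w + ε) ^ 2 :=
      mul_nonneg (hn v).le (sq_nonneg _)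
    rw [e, abs_mul, abs_of_nonneg hp]
    nlinarith [mul_le_mul_of_nonneg_left h hp]
  rw [← hF.sq_localNorm hx w]
  have hc : Tendsto (fun ε : ℝ => 6 * (localNorm F x v + ε) * (localNorm F x w + ε) ^ 2)
      (𝓝[>] 0) (𝓝 (6 * (localNorm F x v + 0) * (localNorm F x w + 0) ^ 2)) :=
    tendsto_nhdsWithin_of_tendsto_nhds (Continuous.tendsto (by fun_prop) 0)
  simp only [add_zero] at hc
  exact ge_of_tendsto hc (by filter_upwards [self_mem_nhdsWithin] with ε hε using key ε hε)

/-- The derivative of `t ↦ ‖w‖²` in the local norm along a curve `γ`. -/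
lemma hasDerivAt_hessQuad (hF : IsSelfConcordantBarrier K F ν) {γ : ℝ → Eu d} {γ' : Eu d} {t : ℝ}
    (hγ : HasDerivAt γ γ' t) (ht : γ t ∈ interior K) (w : Eu d) :
    HasDerivAt (fun τ => hessQuad F (γ τ) w) (third F (γ t) γ' w w) t := by
  have h := (((hF.hasFDerivAt_hess ht).clm_apply (hasFDerivAt_const w (γ t))).clm_apply
    (hasFDerivAt_const w (γ t))).comp_hasDerivAt t hγ
  simpa [Function.comp_def, hessQuad_eq, third] using h

lemma continuousOn_hess (hF : IsSelfConcordantBarrier K F ν) :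
    ContinuousOn (fderiv ℝ (fderiv ℝ F)) (interior K) := fun _ hx =>
  (hF.hasFDerivAt_hess hx).continuousAt.continuousWithinAt

end IsSelfConcordantBarrier

end Hessian

/-! ### Comparison of local norms along a path -/

section Path

/-- `γ` is a `C¹` path in the interior of `K`, parametrized by `[0, 1]`, with velocity `γ'`. -/
structure IsInteriorPath (K : Set (Eu d)) (γ γ' : ℝ → Eu d) : Prop where
  mem : ∀ t ∈ Set.Icc (0 : ℝ) 1, γ t ∈ interior K
  continuousOn : ContinuousOn γ (Set.Icc 0 1)
  hasDerivAt : ∀ t ∈ Set.Ioo (0 : ℝ) 1, HasDerivAt γ (γ' t) t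
  continuousOn_velocity : ContinuousOn γ' (Set.Icc 0 1)

/-- The Riemannian length of the part of the path `γ` up to time `t`. -/
def arcLength (F : Eu d → ℝ) (γ γ' : ℝ → Eu d) (t : ℝ) : ℝ :=
  ∫ τ in (0 : ℝ)..t, localNorm F (γ τ) (γ' τ)

variable {K : Set (Eu d)} {F : Eu d → ℝ} {ν : ℕ} {γ γ' : ℝ → Eu d}

lemma arcLength_zero : arcLength F γ γ' 0 = 0 := by simp [arcLength]

namespace IsInteriorPath

lemma continuousOn_hessQuad (hγ : IsInteriorPath K γ γ') (hF : IsSelfConcordantBarrier K F ν)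
    {v : ℝ → Eu d} (hv : ContinuousOn v (Set.Icc 0 1)) :
    ContinuousOn (fun t => hessQuad F (γ t) (v t)) (Set.Icc 0 1) := by
  have h := hF.continuousOn_hess.comp hγ.continuousOn hγ.mem
  simp only [hessQuad_eq]
  exact (h.clm_apply hv).clm_apply hv

lemma continuousOn_speed (hγ : IsInteriorPath K γ γ') (hF : IsSelfConcordantBarrier K F ν) :
    ContinuousOn (fun t => localNorm F (γ t) (γ' t)) (Set.Icc 0 1) :=
  Real.continuous_sqrt.comp_continuousOn (hγ.continuousOn_hessQuad hF hγ.continuousOn_velocity)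

lemma hasDerivAt_arcLength (hγ : IsInteriorPath K γ γ') (hF : IsSelfConcordantBarrier K F ν)
    {t : ℝ} (ht : t ∈ Set.Ioo (0 : ℝ) 1) :
    HasDerivAt (arcLength F γ γ') (localNorm F (γ t) (γ' t)) t := by
  have hc := hγ.continuousOn_speed hF
  have hsub : Set.Icc 0 t ⊆ Set.Icc (0 : ℝ) 1 := Set.Icc_subset_Icc_right ht.2.le
  refine intervalIntegral.integral_hasDerivAt_right ?_ ?_ ?_
  · apply ContinuousOn.intervalIntegrable
    rw [Set.uIcc_of_le ht.1.le]
    exact hc.mono hsub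
  · exact (hc.mono Set.Ioo_subset_Icc_self).stronglyMeasurableAtFilter isOpen_Ioo t ht
  · exact hc.continuousAt (Icc_mem_nhds ht.1 ht.2)

lemma continuousOn_arcLength (hγ : IsInteriorPath K γ γ') (hF : IsSelfConcordantBarrier K F ν) :
    ContinuousOn (arcLength F γ γ') (Set.Icc 0 1) := by
  have hc := (hγ.continuousOn_speed hF).integrableOn_Icc (μ := volume)
  rw [← Set.uIcc_of_le (zero_le_one' ℝ)] at hc ⊢
  exact intervalIntegral.continuousOn_primitive_interval hc

lemma monotoneOn_arcLength (hγ : IsInteriorPath K γ γ') (hF : IsSelfConcordantBarrier K F ν) :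
    MonotoneOn (arcLength F γ γ') (Set.Icc 0 1) := by
  refine monotoneOn_of_hasDerivWithinAt_nonneg (convex_Icc 0 1) (hγ.continuousOn_arcLength hF)
    (f' := fun t => localNorm F (γ t) (γ' t)) (fun t ht => ?_)
    (fun t _ => localNorm_nonneg F _ _)
  rw [interior_Icc] at ht
  exact (hγ.hasDerivAt_arcLength hF ht).hasDerivWithinAt

lemma arcLength_nonneg (hγ : IsInteriorPath K γ γ') (hF : IsSelfConcordantBarrier K F ν)
    {t : ℝ} (ht : t ∈ Set.Icc (0 : ℝ) 1) : 0 ≤ arcLength F γ γ' t := by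
  have := hγ.monotoneOn_arcLength hF (Set.left_mem_Icc.2 zero_le_one) ht ht.1
  rwa [arcLength_zero] at this

/-- By Grönwall, the squared local norm of a fixed vector changes by a factor of at most
`exp (6 L)` along a path of length `L`. -/
lemma hessQuad_le (hγ : IsInteriorPath K γ γ') (hF : IsSelfConcordantBarrier K F ν) {s t : ℝ}
    (hs : s ∈ Set.Icc (0 : ℝ) 1) (ht : t ∈ Set.Icc (0 : ℝ) 1) (w : Eu d) :
    hessQuad F (γ t) w ≤ Real.exp (6 * arcLength F γ γ' 1) * hessQuad F (γ s) w := by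
  have hcq := hγ.continuousOn_hessQuad hF (continuousOn_const (c := w))
  have hca := hγ.continuousOn_arcLength hF
  have hmon := hγ.monotoneOn_arcLength hF
  have one_mem : (1 : ℝ) ∈ Set.Icc (0 : ℝ) 1 := Set.right_mem_Icc.2 zero_le_one
  have hbound : ∀ u ∈ Set.Icc (0 : ℝ) 1, |third F (γ u) (γ' u) w w| ≤
      6 * localNorm F (γ u) (γ' u) * hessQuad F (γ u) w := fun u hu =>
    hF.abs_third_le (hγ.mem u hu) _ _
  have hder : ∀ (c : ℝ) (u : ℝ), u ∈ Set.Ioo (0 : ℝ) 1 → HasDerivAt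
      (fun u => hessQuad F (γ u) w * Real.exp (c * arcLength F γ γ' u))
      ((third F (γ u) (γ' u) w w + c * localNorm F (γ u) (γ' u) * hessQuad F (γ u) w) *
        Real.exp (c * arcLength F γ γ' u)) u := by
    intro c u hu
    have h1 := hF.hasDerivAt_hessQuad (hγ.hasDerivAt u hu)
      (hγ.mem u (Set.Ioo_subset_Icc_self hu)) w
    have h2 := ((hγ.hasDerivAt_arcLength hF hu).const_mul c).exp
    refine (h1.mul h2).congr_deriv ?_
    ring
  have hcont : ∀ c : ℝ, ContinuousOn
      (fun u => hessQuad F (γ u) w * Real.exp (c * arcLength F γ γ' u)) (Set.Icc 0 1) := fun c =>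
    hcq.mul (Real.continuous_exp.comp_continuousOn (continuousOn_const.mul hca))
  have hanti := antitoneOn_of_hasDerivWithinAt_nonpos (convex_Icc (0 : ℝ) 1) (hcont (-6))
    (fun u hu => (hder (-6) u (by rwa [interior_Icc] at hu)).hasDerivWithinAt) (fun u hu => by
      apply mul_nonpos_of_nonpos_of_nonneg _ (Real.exp_pos _).le
      linarith [(abs_le.1 (hbound u (interior_subset hu))).2])
  have hmono := monotoneOn_of_hasDerivWithinAt_nonneg (convex_Icc (0 : ℝ) 1) (hcont 6)
    (fun u hu => (hder 6 u (by rwa [interior_Icc] at hu)).hasDerivWithinAt) (fun u hu => by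
      apply mul_nonneg _ (Real.exp_pos _).le
      linarith [(abs_le.1 (hbound u (interior_subset hu))).1])
  have hqs := hF.hessQuad_nonneg (hγ.mem s hs) w
  have hs0 := hγ.arcLength_nonneg hF hs
  have ht0 := hγ.arcLength_nonneg hF ht
  have hs1 := hmon hs one_mem hs.2
  have ht1 := hmon ht one_mem ht.2
  rcases le_total s t with hst | hst
  · have h := hanti hs ht hst
    simp only at h
    calc hessQuad F (γ t) w = hessQuad F (γ t) w * Real.exp (-6 * arcLength F γ γ' t) *
          Real.exp (6 * arcLength F γ γ' t) := by
          rw [mul_assoc, ← Real.exp_add]; ring_nf; simp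
      _ ≤ hessQuad F (γ s) w * Real.exp (-6 * arcLength F γ γ' s) *
          Real.exp (6 * arcLength F γ γ' t) := by gcongr
      _ = Real.exp (-6 * arcLength F γ γ' s + 6 * arcLength F γ γ' t) * hessQuad F (γ s) w := by
          rw [Real.exp_add]; ring
      _ ≤ _ := by gcongr; linarith
  · have h := hmono ht hs hst
    simp only at h
    calc hessQuad F (γ t) w = hessQuad F (γ t) w * Real.exp (6 * arcLength F γ γ' t) *
          Real.exp (-6 * arcLength F γ γ' t) := by
          rw [mul_assoc, ← Real.exp_add]; ring_nf; simp
      _ ≤ hessQuad F (γ s) w * Real.exp (6 * arcLength F γ γ' s) *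
          Real.exp (-6 * arcLength F γ γ' t) := by gcongr
      _ = Real.exp (6 * arcLength F γ γ' s + -6 * arcLength F γ γ' t) * hessQuad F (γ s) w := by
          rw [Real.exp_add]; ring
      _ ≤ _ := by gcongr; linarith

lemma localNorm_le (hγ : IsInteriorPath K γ γ') (hF : IsSelfConcordantBarrier K F ν) {s t : ℝ}
    (hs : s ∈ Set.Icc (0 : ℝ) 1) (ht : t ∈ Set.Icc (0 : ℝ) 1) (w : Eu d) :
    localNorm F (γ t) w ≤ Real.exp (3 * arcLength F γ γ' 1) * localNorm F (γ s) w := by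
  apply Real.sqrt_le_iff.2
  refine ⟨mul_nonneg (Real.exp_pos _).le (localNorm_nonneg F _ _), ?_⟩
  rw [mul_pow, hF.sq_localNorm (hγ.mem s hs), ← Real.exp_nat_mul]
  refine (hγ.hessQuad_le hF hs ht w).trans_eq ?_
  push_cast; ring_nf

/-- Displacement is bounded by arc length, also in the local norm at another point of the path. -/
lemma localNorm_sub_le (hγ : IsInteriorPath K γ γ') (hF : IsSelfConcordantBarrier K F ν)
    {s t τ : ℝ} (hs : s ∈ Set.Icc (0 : ℝ) 1) (ht : t ∈ Set.Icc (0 : ℝ) 1) (hst : s ≤ t)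
    (hτ : τ ∈ Set.Icc (0 : ℝ) 1) :
    localNorm F (γ τ) (γ t - γ s) ≤
      Real.exp (3 * arcLength F γ γ' 1) * (arcLength F γ γ' t - arcLength F γ γ' s) := by
  set E := Real.exp (3 * arcLength F γ γ' 1)
  set w := γ t - γ s with hw
  have hf : ∀ u ∈ Set.Ioo (0 : ℝ) 1, HasDerivAt (fun u => hessForm F (γ τ) w (γ u) -
      E * localNorm F (γ τ) w * arcLength F γ γ' u) (hessForm F (γ τ) w (γ' u) -
      E * localNorm F (γ τ) w * localNorm F (γ u) (γ' u)) u := by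
    intro u hu
    refine HasDerivAt.sub ?_ ((hγ.hasDerivAt_arcLength hF hu).const_mul _)
    exact (LinearMap.toContinuousLinearMap (hessForm F (γ τ) w)).hasFDerivAt.comp_hasDerivAt u
      (hγ.hasDerivAt u hu)
  have hanti := antitoneOn_of_hasDerivWithinAt_nonpos (convex_Icc (0 : ℝ) 1)
    (f := fun u => hessForm F (γ τ) w (γ u) - E * localNorm F (γ τ) w * arcLength F γ γ' u)
    (((LinearMap.toContinuousLinearMap (hessForm F (γ τ) w)).continuous.comp_continuousOn
      hγ.continuousOn).sub (continuousOn_const.mul (hγ.continuousOn_arcLength hF)))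
    (fun u hu => (hf u (by rwa [interior_Icc] at hu)).hasDerivWithinAt) (fun u hu => by
      have h1 := (le_abs_self _).trans (hF.abs_hessForm_le (hγ.mem τ hτ) w (γ' u))
      have h2 := mul_le_mul_of_nonneg_left (hγ.localNorm_le hF (interior_subset hu) hτ (γ' u))
        (localNorm_nonneg F (γ τ) w)
      simp only [E]
      linarith)
  have h := hanti hs ht hst
  simp only at h
  have h3 : localNorm F (γ τ) w ^ 2 ≤ localNorm F (γ τ) w *
      (E * (arcLength F γ γ' t - arcLength F γ γ' s)) := by
    rw [hF.sq_localNorm (hγ.mem τ hτ), hessQuad]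
    nth_rewrite 2 [hw]
    rw [map_sub]; linarith
  rcases (localNorm_nonneg F (γ τ) w).eq_or_lt' with h0 | h0
  · rw [h0]
    exact mul_nonneg (Real.exp_pos _).le (sub_nonneg.2 (hγ.monotoneOn_arcLength hF hs ht hst))
  · rw [sq] at h3
    exact le_of_mul_le_mul_left h3 h0

/-- If `s` is within `c` of being linear with slope `g` at local distances below `ρ`, then it is so
up to `(n + 1) c` between the ends of a path which can be cut into `n` pieces of length `ε`, where
`ε` is so small that the pieces are short in the local norms at all points of the path. -/
lemma abs_sub_inner_le (hγ : IsInteriorPath K γ γ') (hF : IsSelfConcordantBarrier K F ν)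
    {s : Eu d → ℝ} {g : Eu d} {c ρ ε : ℝ} (hε : 0 < ε)
    (hs : ∀ z ∈ interior K, ∀ w ∈ K, localNorm F z (z - w) < ρ →
      |s z - s w - inner ℝ g (z - w)| < c)
    (hρ : Real.exp (3 * arcLength F γ γ' 1) * ε < ρ) {n : ℕ} {t : ℝ}
    (ht : t ∈ Set.Icc (0 : ℝ) 1) (hn : arcLength F γ γ' t ≤ n * ε) :
    |s (γ t) - s (γ 0) - inner ℝ g (γ t - γ 0)| ≤ (n + 1) * c := by
  have short : ∀ t₁ ∈ Set.Icc (0 : ℝ) 1, ∀ t₂ ∈ Set.Icc (0 : ℝ) 1, t₁ ≤ t₂ →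
      arcLength F γ γ' t₂ - arcLength F γ γ' t₁ ≤ ε →
      |s (γ t₂) - s (γ t₁) - inner ℝ g (γ t₂ - γ t₁)| < c := by
    intro t₁ h₁ t₂ h₂ h12 ha
    refine hs _ (hγ.mem _ h₂) _ (interior_subset (hγ.mem _ h₁)) ?_
    refine (hγ.localNorm_sub_le hF h₁ h₂ h12 h₂).trans_lt (lt_of_le_of_lt ?_ hρ)
    gcongr
  have zero_mem : (0 : ℝ) ∈ Set.Icc (0 : ℝ) 1 := Set.left_mem_Icc.2 zero_le_one
  have hc : 0 ≤ c := (abs_nonneg _).trans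
    (short 0 zero_mem 0 zero_mem le_rfl (by simpa using hε.le)).le
  induction n generalizing t with
  | zero =>
    have := short 0 zero_mem t ht ht.1 (by
      rw [arcLength_zero]; push_cast at hn; linarith)
    simpa using this.le
  | succ n ih =>
    by_cases hlt : arcLength F γ γ' t ≤ n * ε
    · refine (ih ht hlt).trans ?_
      push_cast; nlinarith
    · rw [not_le] at hlt
      obtain ⟨t', ht', he⟩ : (n * ε : ℝ) ∈ arcLength F γ γ' '' Set.Icc 0 t := by
        apply intermediate_value_Icc ht.1
          ((hγ.continuousOn_arcLength hF).mono (Set.Icc_subset_Icc_right ht.2))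
        rw [arcLength_zero]
        exact ⟨by positivity, hlt.le⟩
      have hm' : t' ∈ Set.Icc (0 : ℝ) 1 := ⟨ht'.1, ht'.2.trans ht.2⟩
      have h1 := ih hm' he.le
      have h2 := short t' hm' t ht ht'.2 (by push_cast at hn; linarith)
      have e : s (γ t) - s (γ 0) - inner ℝ g (γ t - γ 0) =
          (s (γ t) - s (γ t') - inner ℝ g (γ t - γ t')) +
          (s (γ t') - s (γ 0) - inner ℝ g (γ t' - γ 0)) := by
        simp only [inner_sub_right]; ring
      rw [e]
      refine (abs_add_le _ _).trans ?_
      push_cast; linarith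

end IsInteriorPath

/-- Two points at finite Riemannian distance are joined by a path of almost minimal length. -/
lemma exists_isInteriorPath_of_riemDist_lt (hF : IsSelfConcordantBarrier K F ν) {x y : Eu d}
    {δ : ℝ} (hδ : riemDist K F x y < ENNReal.ofReal δ) :
    ∃ γ γ' : ℝ → Eu d, IsInteriorPath K γ γ' ∧ γ 0 = x ∧ γ 1 = y ∧ arcLength F γ γ' 1 < δ := by
  simp only [riemDist, iInf_lt_iff] at hδ
  obtain ⟨γ, h1, h2, h3, h4, h5⟩ := hδ
  have hu : UniqueDiffOn ℝ (Set.Icc (0 : ℝ) 1) := uniqueDiffOn_Icc zero_lt_one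
  have hγ : IsInteriorPath K γ (derivWithin γ (Set.Icc 0 1)) :=
    { mem := h2
      continuousOn := h1.continuousOn
      hasDerivAt := fun t ht => by
        have := (h1.differentiableOn one_ne_zero t (Set.Ioo_subset_Icc_self ht)).hasDerivWithinAt
        exact this.hasDerivAt (Icc_mem_nhds ht.1 ht.2)
      continuousOn_velocity := h1.continuousOn_derivWithin hu le_rfl }
  refine ⟨γ, _, hγ, h3, h4, ?_⟩
  have hint := (hγ.continuousOn_speed hF).integrableOn_Icc (μ := volume)
  rw [pathLength, ← ofReal_integral_eq_lintegral_ofReal hint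
    (ae_of_all _ fun t => localNorm_nonneg F _ _), integral_Icc_eq_integral_Ioc,
    ← intervalIntegral.integral_of_le zero_le_one] at h5
  exact ((ENNReal.ofReal_lt_ofReal_iff').1 h5).1

end Path

/-! ### The Dikin ellipsoid -/

section Dikin

variable {K : Set (Eu d)} {F : Eu d → ℝ} {ν : ℕ} {x : Eu d}

lemma hasDerivAt_line (x v : Eu d) (t : ℝ) : HasDerivAt (fun τ : ℝ => x + τ • v) v t := by
  simpa using ((hasDerivAt_id t).smul_const v).const_add x

namespace IsSelfConcordantBarrier

/-- Self-concordance along a line: `‖v‖_{x + t v}` at most doubles for `t ≤ 1` when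
`‖v‖_x < 1 / 2`, as long as the segment stays in the interior. -/
lemma hessQuad_line_le (hF : IsSelfConcordantBarrier K F ν) {v : Eu d} {T : ℝ} (hT0 : 0 ≤ T)
    (hT1 : T ≤ 1) (hmem : ∀ t ∈ Set.Icc 0 T, x + t • v ∈ interior K)
    (hv : hessQuad F x v < 1 / 4) : hessQuad F (x + T • v) v ≤ 4 * hessQuad F x v := by
  set φ : ℝ → ℝ := fun t => hessQuad F (x + t • v) v with hφ
  have hφ0 : φ 0 = hessQuad F x v := by simp [hφ]
  have hnn : ∀ t ∈ Set.Icc 0 T, 0 ≤ φ t := fun t ht => hF.hessQuad_nonneg (hmem t ht) v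
  have hx0 : 0 ≤ φ 0 := hnn 0 (Set.left_mem_Icc.2 hT0)
  -- `(φ + ε)^{-1/2}` has slope at least `-1`; the shift by `ε` avoids the zeros of `φ`.
  have key : ∀ ε > 0, φ 0 + ε ≤ 1 / 4 → φ T ≤ 4 * φ 0 + 4 * ε := by
    intro ε hε hsmall
    have hder : ∀ t ∈ Set.Icc 0 T, ∃ D : ℝ, -1 ≤ D ∧
        HasDerivAt (fun t => (√(φ t + ε))⁻¹) D t := by
      intro t ht
      have hp : 0 < φ t + ε := add_pos_of_nonneg_of_pos (hnn t ht) hε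
      have hs : 0 < √(φ t + ε) := Real.sqrt_pos.2 hp
      have h1 : HasDerivAt φ (third F (x + t • v) v v v) t :=
        hF.hasDerivAt_hessQuad (hasDerivAt_line x v t) (hmem t ht) v
      refine ⟨_, ?_, ((h1.add_const ε).sqrt hp.ne').inv hs.ne'⟩
      have h3 := (abs_le.1 (hF.abs_third_diag_le (hmem t ht) v)).2
      have h4 : localNorm F (x + t • v) v ≤ √(φ t + ε) := Real.sqrt_le_sqrt (by
        change φ t ≤ _; linarith)
      have h5 := pow_le_pow_left₀ (localNorm_nonneg F (x + t • v) v) h4 3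
      rw [neg_div, neg_le_neg_iff, div_le_one (pow_pos hs 2), div_le_iff₀ (by positivity)]
      nlinarith
    choose! D hD1 hD2 using hder
    have hmono := monotoneOn_of_hasDerivWithinAt_nonneg (convex_Icc 0 T)
      (f := fun t => (√(φ t + ε))⁻¹ + t) (f' := fun t => D t + 1)
      (fun t ht => ((hD2 t ht).continuousAt.add continuousAt_id).continuousWithinAt)
      (fun t ht => ((hD2 t (interior_subset ht)).add (hasDerivAt_id t)).hasDerivWithinAt)
      (fun t ht => by linarith [hD1 t (interior_subset ht)])
    have h := hmono (Set.left_mem_Icc.2 hT0) (Set.right_mem_Icc.2 hT0) hT0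
    simp only [add_zero] at h
    have hp0 : 0 < φ 0 + ε := add_pos_of_nonneg_of_pos hx0 hε
    have hpT : 0 < φ T + ε := add_pos_of_nonneg_of_pos (hnn T (Set.right_mem_Icc.2 hT0)) hε
    have hs0 := Real.sqrt_pos.2 hp0
    have hsT := Real.sqrt_pos.2 hpT
    have hle : √(φ 0 + ε) ≤ 1 / 2 := by
      rw [Real.sqrt_le_left (by norm_num)]; norm_num; linarith
    have h2 : 2 ≤ (√(φ 0 + ε))⁻¹ := by
      rw [le_inv_comm₀ (by norm_num) hs0]; linarith
    have h3 : (2 * √(φ 0 + ε))⁻¹ ≤ (√(φ T + ε))⁻¹ := by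
      rw [mul_inv]; linarith
    have h4 := (inv_le_inv₀ (by positivity) hsT).1 h3
    have h5 := pow_le_pow_left₀ hsT.le h4 2
    rw [mul_pow, Real.sq_sqrt hpT.le, Real.sq_sqrt hp0.le] at h5
    linarith
  have hlim : Tendsto (fun ε : ℝ => 4 * φ 0 + 4 * ε) (𝓝[>] 0) (𝓝 (4 * φ 0 + 4 * 0)) :=
    tendsto_nhdsWithin_of_tendsto_nhds (Continuous.tendsto (by fun_prop) 0)
  rw [mul_zero, add_zero] at hlim
  rw [← hφ0] at hv ⊢
  refine ge_of_tendsto hlim ?_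
  filter_upwards [Ioo_mem_nhdsGT (show (0 : ℝ) < 1 / 4 - φ 0 by linarith)] with ε hε
  exact key ε hε.1 (by linarith [hε.2])

/-- The Dikin ellipsoid of radius `1 / 2` lies in the interior of `K`: along a ray to a first exit
point, the derivative of the barrier would remain bounded. -/
lemma add_smul_mem_interior (hF : IsSelfConcordantBarrier K F ν) (hx : x ∈ interior K) {v : Eu d}
    (hv : hessQuad F x v < 1 / 4) {t : ℝ} (ht : t ∈ Set.Icc (0 : ℝ) 1) :
    x + t • v ∈ interior K := by
  by_contra hcon
  have hcl : IsClosed {t : ℝ | x + t • v ∉ interior K} :=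
    (isOpen_interior.preimage (by fun_prop : Continuous fun t : ℝ => x + t • v)).isClosed_compl
  obtain ⟨T, ⟨hT1, hT2⟩, hmin⟩ := (isCompact_Icc.inter_right hcl).exists_isLeast ⟨t, ht, hcon⟩
  have hlt : ∀ τ, 0 ≤ τ → τ < T → x + τ • v ∈ interior K := by
    intro τ h0 h1
    by_contra h
    exact absurd (hmin ⟨⟨h0, h1.le.trans hT1.2⟩, h⟩) (not_le.2 h1)
  have hTpos : 0 < T := by
    rcases hT1.1.eq_or_lt with h | h
    · exact absurd hx (by simpa [← h] using hT2)
    · exact h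
  have hbound : ∀ τ, 0 ≤ τ → τ < T → F (x + τ • v) ≤ F x + ν := by
    intro τ h0 h1
    have hm : ∀ u ∈ Set.Icc 0 τ, x + u • v ∈ interior K := fun u hu =>
      hlt u hu.1 (hu.2.trans_lt h1)
    have hd : ∀ u ∈ Set.Icc 0 τ, HasDerivAt (fun u => F (x + u • v) - ν * u)
        (fderiv ℝ F (x + u • v) v - ν * 1) u := fun u hu =>
      ((((hF.contDiffAt (hm u hu)).differentiableAt (by norm_num)).hasFDerivAt).comp_hasDerivAt u
        (hasDerivAt_line x v u)).sub ((hasDerivAt_id u).const_mul _)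
    have hν : (1 : ℝ) ≤ ν := by exact_mod_cast hF.param_pos
    have hanti := antitoneOn_of_hasDerivWithinAt_nonpos (convex_Icc 0 τ)
      (fun u hu => (hd u hu).continuousAt.continuousWithinAt)
      (fun u hu => (hd u (interior_subset hu)).hasDerivWithinAt) (fun u hu => by
        have hu' := interior_subset hu
        have h2 : hessQuad F (x + u • v) v ≤ 1 := by
          refine (hF.hessQuad_line_le hu'.1 (hu'.2.trans (h1.le.trans hT1.2))
            (fun a ha => hm a ⟨ha.1, ha.2.trans hu'.2⟩) hv).trans (by linarith)
        have h3 : |fderiv ℝ F (x + u • v) v| ^ 2 ≤ ν * hessQuad F (x + u • v) v :=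
          hF.first_le _ (hm u hu') v
        have h4 := abs_le_of_sq_le_sq' (a := fderiv ℝ F (x + u • v) v) (b := (ν : ℝ))
          (by rw [← sq_abs]; nlinarith) (by linarith)
        linarith [h4.2])
    have h := hanti (Set.left_mem_Icc.2 h0) (Set.right_mem_Icc.2 h0) h0
    simp only [zero_smul, add_zero, mul_zero, sub_zero] at h
    nlinarith [hT1.2]
  have hu : ∀ n : ℕ, 0 ≤ T * (1 - 1 / ((n : ℝ) + 1)) ∧ T * (1 - 1 / ((n : ℝ) + 1)) < T := by
    intro n
    have h1 : (1 : ℝ) / (n + 1) ≤ 1 := by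
      rw [div_le_one (by positivity)]; linarith [(Nat.cast_nonneg n : (0 : ℝ) ≤ n)]
    have h2 : (0 : ℝ) < 1 / (n + 1) := by positivity
    constructor
    · exact mul_nonneg hTpos.le (by linarith)
    · nlinarith
  have hlim : Tendsto (fun n : ℕ => x + (T * (1 - 1 / ((n : ℝ) + 1))) • v) atTop
      (𝓝 (x + T • v)) := by
    have h1 := (tendsto_one_div_add_atTop_nhds_zero_nat (𝕜 := ℝ)).const_sub 1 |>.const_mul T
    rw [sub_zero, mul_one] at h1
    exact (h1.smul_const v).const_add x
  have htop := hF.barrier _ (fun n => hlt _ (hu n).1 (hu n).2) _ hT2 hlim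
  obtain ⟨n, hn⟩ := (htop.eventually_gt_atTop (F x + ν)).exists
  exact absurd (hbound _ (hu n).1 (hu n).2) (not_le.2 hn)

/-- The segment to a point of the Dikin ellipsoid of radius `1 / 2` is a path in the interior, of
length at most twice the local norm of the displacement. -/
lemma isInteriorPath_segment (hF : IsSelfConcordantBarrier K F ν) (hx : x ∈ interior K) {v : Eu d}
    (hv : hessQuad F x v < 1 / 4) : IsInteriorPath K (fun t => x + t • v) (fun _ => v) ∧
      arcLength F (fun t => x + t • v) (fun _ => v) 1 ≤ 2 * localNorm F x v := by
  have hpath : IsInteriorPath K (fun t => x + t • v) (fun _ => v) :=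
    { mem := fun t ht => hF.add_smul_mem_interior hx hv ht
      continuousOn := by fun_prop
      hasDerivAt := fun t _ => hasDerivAt_line x v t
      continuousOn_velocity := continuousOn_const }
  refine ⟨hpath, ?_⟩
  have hb : ∀ t ∈ Set.Icc (0 : ℝ) 1, localNorm F (x + t • v) v ≤ 2 * localNorm F x v := by
    intro t ht
    apply Real.sqrt_le_iff.2
    refine ⟨mul_nonneg zero_le_two (localNorm_nonneg F _ _), ?_⟩
    rw [mul_pow, hF.sq_localNorm hx]
    refine (hF.hessQuad_line_le ht.1 ht.2 (fun a ha =>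
      hF.add_smul_mem_interior hx hv ⟨ha.1, ha.2.trans ht.2⟩) hv).trans_eq (by norm_num)
  have hint : IntervalIntegrable (fun t => localNorm F (x + t • v) v) volume 0 1 := by
    apply ContinuousOn.intervalIntegrable
    rw [Set.uIcc_of_le zero_le_one]
    exact hpath.continuousOn_speed hF
  have := intervalIntegral.integral_mono_on zero_le_one hint intervalIntegrable_const hb
  simpa [arcLength] using this

/-- The Hessian of a barrier of a bounded set is positive definite. -/
lemma exists_le_hessQuad (hF : IsSelfConcordantBarrier K F ν) (hK : IsCompact K)
    (hx : x ∈ interior K) : ∃ c > 0, ∀ w : Eu d, c * ‖w‖ ^ 2 ≤ hessQuad F x w := by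
  obtain ⟨R, hR0, hR⟩ := hK.isBounded.exists_pos_norm_le
  have hsmall : ∀ v : Eu d, hessQuad F x v < 1 / 4 → ‖v‖ ≤ 2 * R := by
    intro v hv
    have h1 := hR _ (interior_subset
      (hF.add_smul_mem_interior hx hv (Set.right_mem_Icc.2 zero_le_one)))
    have h2 := hR _ (interior_subset hx)
    have h3 := norm_sub_le (x + (1 : ℝ) • v) x
    rw [one_smul] at h1 h3
    rw [add_sub_cancel_left] at h3
    linarith
  refine ⟨(64 * R ^ 2)⁻¹, by positivity, fun w => ?_⟩
  by_contra hcon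
  rw [not_le] at hcon
  have hw : 0 < ‖w‖ := by
    by_contra h
    have : w = 0 := norm_eq_zero.1 (le_antisymm (not_lt.1 h) (norm_nonneg _))
    simp [this, hessQuad] at hcon
  -- The multiple of `w` of norm `4 R` is too long to be in the ellipsoid.
  have h1 : hessQuad F x ((4 * R / ‖w‖) • w) < 1 / 4 := by
    rw [hessQuad_smul]
    calc (4 * R / ‖w‖) ^ 2 * hessQuad F x w
        < (4 * R / ‖w‖) ^ 2 * ((64 * R ^ 2)⁻¹ * ‖w‖ ^ 2) := by gcongr
      _ = 1 / 4 := by field_simp; norm_num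
  have h2 := hsmall _ h1
  rw [norm_smul, Real.norm_of_nonneg (by positivity), div_mul_cancel₀ _ hw.ne'] at h2
  linarith

end IsSelfConcordantBarrier

end Dikin

/-! ### Gaussian integrals in the local metric -/

section Gaussian

variable {K : Set (Eu d)} {F : Eu d → ℝ} {ν : ℕ} {x y : Eu d} {b : ℝ}

/-- The normalizing constant `∫ exp (-b ‖v‖_x²) dv` of the centred Gaussian at `x`. -/
def gaussConst (F : Eu d → ℝ) (b : ℝ) (x : Eu d) : ℝ := ∫ v : Eu d, Real.exp (-(b * hessQuad F x v))

lemma continuous_gauss (F : Eu d → ℝ) (b : ℝ) (x : Eu d) :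
    Continuous fun v => Real.exp (-(b * hessQuad F x v)) := by
  have := continuous_hessQuad F x
  fun_prop

/-- Rescaling the variable of a Gaussian integral; no determinants are needed. -/
lemma integral_gauss_sq_mul (F : Eu d → ℝ) (b : ℝ) (x : Eu d) {c : ℝ} (hc : 0 < c) :
    ∫ v : Eu d, Real.exp (-(b * (c ^ 2 * hessQuad F x v))) = (c ^ d)⁻¹ * gaussConst F b x := by
  have := Measure.integral_comp_smul_of_nonneg volume
    (fun v : Eu d => Real.exp (-(b * hessQuad F x v))) c (hR := hc.le)
  simpa [hessQuad_smul, gaussConst] using this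

namespace IsSelfConcordantBarrier

lemma integrable_gauss (hF : IsSelfConcordantBarrier K F ν) (hK : IsCompact K)
    (hx : x ∈ interior K) (hb : 0 < b) :
    Integrable fun v => Real.exp (-(b * hessQuad F x v)) := by
  obtain ⟨c, hc, hle⟩ := hF.exists_le_hessQuad hK hx
  have h := GaussianFourier.integrable_cexp_neg_mul_sq_norm_add (V := Eu d) (b := ((b * c : ℝ) : ℂ))
    (by rw [Complex.ofReal_re]; positivity) 0 0
  have h2 := h.norm
  refine h2.mono' (continuous_gauss F b x).aestronglyMeasurable (ae_of_all _ fun v => ?_)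
  rw [Real.norm_of_nonneg (Real.exp_pos _).le, Complex.norm_exp, Real.exp_le_exp]
  have := mul_le_mul_of_nonneg_left (hle v) hb.le
  have e : (-((b * c : ℝ) : ℂ) * ((‖v‖ : ℝ) : ℂ) ^ 2 + 0 * ((inner ℝ (0 : Eu d) v : ℝ) : ℂ)).re =
      -(b * c) * ‖v‖ ^ 2 := by
    rw [zero_mul, add_zero, ← Complex.ofReal_pow, ← Complex.ofReal_neg, ← Complex.ofReal_mul,
      Complex.ofReal_re]
  rw [e]
  linarith

lemma gaussConst_pos (hF : IsSelfConcordantBarrier K F ν) (hK : IsCompact K)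
    (hx : x ∈ interior K) (hb : 0 < b) : 0 < gaussConst F b x :=
  integral_exp_pos (hF.integrable_gauss hK hx hb)

/-- If `‖·‖_y² ≤ e^a ‖·‖_x²`, then the normalizing constant at `y` is at least `e^{-ad/2}` times
the one at `x`. -/
lemma exp_mul_gaussConst_le (hF : IsSelfConcordantBarrier K F ν) (hK : IsCompact K)
    (hx : x ∈ interior K) (hy : y ∈ interior K) (hb : 0 < b) {a : ℝ}
    (h : ∀ v, hessQuad F y v ≤ Real.exp a * hessQuad F x v) :
    Real.exp (-(a * d / 2)) * gaussConst F b x ≤ gaussConst F b y := by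
  have hsq : Real.exp (a / 2) ^ 2 = Real.exp a := by
    rw [← Real.exp_nat_mul]; push_cast; ring_nf
  have h1 := integral_gauss_sq_mul F b x (Real.exp_pos (a / 2))
  rw [hsq, ← Real.exp_nat_mul, ← Real.exp_neg] at h1
  have e : -(a * d / 2) = -(d * (a / 2)) := by ring
  rw [e, ← h1]
  refine integral_mono ?_ (hF.integrable_gauss hK hy hb) fun v => ?_
  · have := hF.integrable_gauss hK hx (mul_pos hb (Real.exp_pos a))
    simpa only [mul_assoc] using this
  · simp only [Real.exp_le_exp, neg_le_neg_iff]
    exact mul_le_mul_of_nonneg_left (h v) hb.le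

/-- A half-space through the centre carries at least half of the Gaussian mass. -/
lemma gaussConst_le_two_mul_setIntegral (hF : IsSelfConcordantBarrier K F ν) (hK : IsCompact K)
    (hx : x ∈ interior K) (hb : 0 < b) (g : Eu d) :
    gaussConst F b x ≤
      2 * ∫ v, {v : Eu d | inner ℝ g v ≤ 0}.indicator
        (fun v => Real.exp (-(b * hessQuad F x v))) v := by
  have hm : MeasurableSet {v : Eu d | inner ℝ g v ≤ 0} :=
    (isClosed_le (by fun_prop) continuous_const).measurableSet
  set f := {v : Eu d | inner ℝ g v ≤ 0}.indicator (fun v => Real.exp (-(b * hessQuad F x v)))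
    with hf
  have hi : Integrable f := (hF.integrable_gauss hK hx hb).indicator hm
  have h1 : ∫ v, f (-v) = ∫ v, f v := integral_neg_eq_self f volume
  have h2 : 2 * ∫ v, f v = ∫ v, (f v + f (-v)) := by
    rw [integral_add hi hi.comp_neg, h1]; ring
  rw [h2]
  refine integral_mono (hF.integrable_gauss hK hx hb) (hi.add hi.comp_neg) fun v => ?_
  have hpos : ∀ u, 0 ≤ f u := fun u => Set.indicator_nonneg (fun _ _ => (Real.exp_pos _).le) u
  rcases le_total (inner ℝ g v) 0 with h | h
  · have : f v = Real.exp (-(b * hessQuad F x v)) :=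
      Set.indicator_of_mem (show v ∈ {v : Eu d | inner ℝ g v ≤ 0} from h) _
    linarith [hpos (-v)]
  · have hmem : -v ∈ {v : Eu d | inner ℝ g v ≤ 0} := by
      change inner ℝ g (-v) ≤ 0
      rw [inner_neg_right]; linarith
    have : f (-v) = Real.exp (-(b * hessQuad F x v)) := by
      rw [hf, Set.indicator_of_mem hmem, hessQuad_neg]
    linarith [hpos v]

end IsSelfConcordantBarrier

/-- The displacements `v` from `x` on which both transition laws are controlled: `v` is not much
longer than typical under the Gaussian (up to the factor `θ`), the step `w` to the other centre does
not point too far away from `v`, and the linear functional `g` does not increase along `v`. -/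
def goodSet (F : Eu d → ℝ) (b θ : ℝ) (x w g : Eu d) : Set (Eu d) :=
  {v | b * hessQuad F x v ≤ 4 * d * θ ^ 2} ∩
    ({v | -(2 * b * hessForm F x v w) ≤ b * hessQuad F x w + 3} ∩ {v | inner ℝ g v ≤ 0})

lemma measurableSet_goodSet (F : Eu d → ℝ) (b θ : ℝ) (x w g : Eu d) :
    MeasurableSet (goodSet F b θ x w g) := by
  have h1 : Continuous fun v => hessForm F x v w :=
    (LinearMap.toContinuousLinearMap ((hessForm F x).flip w)).continuous
  have h2 := continuous_hessQuad F x
  refine IsClosed.measurableSet (.inter ?_ (.inter ?_ ?_))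
  · exact isClosed_le (by fun_prop) continuous_const
  · exact isClosed_le (by fun_prop) continuous_const
  · exact isClosed_le (by fun_prop) continuous_const

namespace IsSelfConcordantBarrier

/-- The good set has mass at least `1 / 4`: it misses from a half-space only the two sets where an
exponential moment is large, and completing the square evaluates both moments. -/
lemma gaussConst_div_four_le_goodSet_one (hF : IsSelfConcordantBarrier K F ν) (hK : IsCompact K)
    (hx : x ∈ interior K) (hb : 0 < b) (hd : 1 ≤ d) (w g : Eu d) :
    gaussConst F b x / 4 ≤
      ∫ v, (goodSet F b 1 x w g).indicator (fun v => Real.exp (-(b * hessQuad F x v))) v := by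
  set e : Eu d → ℝ := fun v => Real.exp (-(b * hessQuad F x v)) with he
  have hZ := hF.gaussConst_pos hK hx hb
  have hie : Integrable e := hF.integrable_gauss hK hx hb
  have hm : MeasurableSet {v : Eu d | inner ℝ g v ≤ 0} :=
    (isClosed_le (by fun_prop) continuous_const).measurableSet
  have hi2 : Integrable fun v => Real.exp (-(b * ((1 / 2) ^ 2 * hessQuad F x v))) := by
    have := hF.integrable_gauss hK hx (show 0 < b * (1 / 2) ^ 2 by positivity)
    simpa only [mul_assoc] using this
  have hi3 : Integrable fun v => e (v + w) := hie.comp_add_right w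
  have hi4 : Integrable fun v => Real.exp (-(3 * d : ℝ)) *
      Real.exp (-(b * ((1 / 2) ^ 2 * hessQuad F x v))) + Real.exp (-3) * e (v + w) :=
    (hi2.const_mul _).add (hi3.const_mul _)
  have hp : ∀ v, {v : Eu d | inner ℝ g v ≤ 0}.indicator e v -
      (Real.exp (-(3 * d)) * Real.exp (-(b * ((1 / 2) ^ 2 * hessQuad F x v))) +
        Real.exp (-3) * e (v + w)) ≤ (goodSet F b 1 x w g).indicator e v := by
    intro v
    have p1 : 0 < Real.exp (-(3 * d : ℝ)) * Real.exp (-(b * ((1 / 2) ^ 2 * hessQuad F x v))) := by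
      positivity
    have p2 : 0 < Real.exp (-3) * e (v + w) := by positivity
    have p3 : 0 ≤ (goodSet F b 1 x w g).indicator e v :=
      Set.indicator_nonneg (fun _ _ => (Real.exp_pos _).le) v
    by_cases hg : inner ℝ g v ≤ 0
    · rw [Set.indicator_of_mem (show v ∈ {v : Eu d | inner ℝ g v ≤ 0} from hg)]
      by_cases h1 : b * hessQuad F x v ≤ 4 * d * 1 ^ 2
      · by_cases h2 : -(2 * b * hessForm F x v w) ≤ b * hessQuad F x w + 3
        · rw [Set.indicator_of_mem (show v ∈ goodSet F b 1 x w g from ⟨h1, h2, hg⟩)]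
          linarith
        · have : e v ≤ Real.exp (-3) * e (v + w) := by
            rw [he, ← Real.exp_add, Real.exp_le_exp, hF.hessQuad_add hx]
            linarith
          linarith
      · have : e v ≤
            Real.exp (-(3 * d : ℝ)) * Real.exp (-(b * ((1 / 2) ^ 2 * hessQuad F x v))) := by
          rw [he, ← Real.exp_add, Real.exp_le_exp]
          linarith
        linarith
    · rw [Set.indicator_of_notMem (show v ∉ {v : Eu d | inner ℝ g v ≤ 0} from hg)]
      linarith
  have hint := integral_mono
    ((hie.indicator hm).sub hi4)
    (hie.indicator (measurableSet_goodSet F b 1 x w g)) hp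
  simp only [Pi.sub_apply] at hint
  rw [integral_sub (hie.indicator hm) hi4,
    integral_add (hi2.const_mul _) (hi3.const_mul _), integral_const_mul, integral_const_mul,
    integral_gauss_sq_mul F b x (by norm_num), integral_add_right_eq_self e w] at hint
  have hhalf := hF.gaussConst_le_two_mul_setIntegral hK hx hb g
  have e3 : Real.exp (-3) ≤ 1 / 12 := by
    rw [Real.exp_neg, one_div]
    apply inv_anti₀ (by norm_num)
    have h := pow_le_pow_left₀ (by norm_num) Real.exp_one_gt_d9.le 3
    rw [← Real.exp_nat_mul] at h
    norm_num at h
    linarith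
  have e4 : Real.exp (-(3 * d : ℝ)) * ((1 / 2 : ℝ) ^ d)⁻¹ ≤ 1 / 6 := by
    have : Real.exp (-(3 * d : ℝ)) * ((1 / 2 : ℝ) ^ d)⁻¹ = (2 * Real.exp (-3)) ^ d := by
      rw [mul_pow, ← Real.exp_nat_mul, ← inv_pow]; norm_num; ring_nf
    rw [this]
    calc (2 * Real.exp (-3)) ^ d ≤ (2 * Real.exp (-3)) ^ 1 :=
          pow_le_pow_of_le_one (by positivity) (by linarith) hd
      _ ≤ 1 / 6 := by linarith
  have e5 : ∫ v, e v = gaussConst F b x := rfl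
  rw [e5, ← mul_assoc] at hint
  have e6 := mul_le_mul_of_nonneg_right e4 hZ.le
  have e7 := mul_le_mul_of_nonneg_right e3 hZ.le
  linarith

/-- Shrinking the good set by the factor `θ` costs at most a factor `θ ^ d` of its mass. -/
lemma le_setIntegral_goodSet (hF : IsSelfConcordantBarrier K F ν) (hK : IsCompact K)
    (hx : x ∈ interior K) (hb : 0 < b) (hd : 1 ≤ d) (w g : Eu d) {θ : ℝ} (hθ0 : 0 < θ)
    (hθ1 : θ ≤ 1) :
    θ ^ d / 4 * gaussConst F b x ≤
      ∫ v in goodSet F b θ x w g, Real.exp (-(b * hessQuad F x v)) := by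
  set e : Eu d → ℝ := fun v => Real.exp (-(b * hessQuad F x v)) with he
  have hie : Integrable e := hF.integrable_gauss hK hx hb
  rw [← integral_indicator (measurableSet_goodSet F b θ x w g)]
  have h1 := Measure.integral_comp_smul_of_nonneg volume
    ((goodSet F b θ x w g).indicator e) θ (hR := hθ0.le)
  rw [finrank_euclideanSpace_fin, smul_eq_mul, eq_inv_mul_iff_mul_eq₀ (by positivity)] at h1
  rw [← h1, div_mul_eq_mul_div, mul_div_assoc]
  refine mul_le_mul_of_nonneg_left ?_ (by positivity)
  refine (hF.gaussConst_div_four_le_goodSet_one hK hx hb hd w g).trans ?_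
  have hi' : Integrable fun v => (goodSet F b θ x w g).indicator e (θ • v) :=
    (hie.indicator (measurableSet_goodSet F b θ x w g)).comp_smul hθ0.ne'
  refine integral_mono (hie.indicator (measurableSet_goodSet F b 1 x w g)) hi' fun v => ?_
  have p3 : 0 ≤ (goodSet F b θ x w g).indicator e (θ • v) :=
    Set.indicator_nonneg (fun _ _ => (Real.exp_pos _).le) _
  by_cases hv : v ∈ goodSet F b 1 x w g
  · have hq := hF.hessQuad_nonneg hx v
    have hqw := hF.hessQuad_nonneg hx w
    obtain ⟨v1, v2, v3⟩ := hv
    have hmem : θ • v ∈ goodSet F b θ x w g := by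
      refine ⟨?_, ?_, ?_⟩
      · change b * hessQuad F x (θ • v) ≤ _
        rw [hessQuad_smul]
        have v1' : b * hessQuad F x v ≤ 4 * d * 1 ^ 2 := v1
        nlinarith [mul_le_mul_of_nonneg_left v1' (sq_nonneg θ)]
      · change -(2 * b * hessForm F x (θ • v) w) ≤ _
        rw [map_smul, LinearMap.smul_apply, smul_eq_mul]
        have v2' : -(2 * b * hessForm F x v w) ≤ b * hessQuad F x w + 3 := v2
        have : 0 ≤ b * hessQuad F x w + 3 := by positivity
        nlinarith [mul_le_mul_of_nonneg_left v2' hθ0.le]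
      · change inner ℝ g (θ • v) ≤ 0
        rw [inner_smul_right]
        exact mul_nonpos_of_nonneg_of_nonpos hθ0.le v3
    rw [Set.indicator_of_mem (show v ∈ goodSet F b 1 x w g from ⟨v1, v2, v3⟩),
      Set.indicator_of_mem hmem]
    simp only [he, Real.exp_le_exp, hessQuad_smul, neg_le_neg_iff]
    have : θ ^ 2 ≤ 1 := pow_le_one₀ hθ0.le hθ1
    exact mul_le_mul_of_nonneg_left (mul_le_of_le_one_left hq this) hb.le
  · rw [Set.indicator_of_notMem hv]; exact p3

end IsSelfConcordantBarrier

end Gaussian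

/-! ### Transition laws and total variation -/

section Transition

/-- Sub-probability measures with a common part `M` are at distance at most `1 - M(univ)`. -/
lemma tvDist_le_of_le {P Q M : Measure (Eu d)} (hP : P Set.univ ≤ 1) (hQ : Q Set.univ ≤ 1)
    (hMP : M ≤ P) (hMQ : M ≤ Q) : tvDist P Q ≤ 1 - M.real Set.univ := by
  have : IsFiniteMeasure P := ⟨hP.trans_lt ENNReal.one_lt_top⟩
  have : IsFiniteMeasure Q := ⟨hQ.trans_lt ENNReal.one_lt_top⟩
  have : IsFiniteMeasure M := isFiniteMeasure_of_le P hMP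
  have key : ∀ (P Q : Measure (Eu d)) [IsFiniteMeasure P] [IsFiniteMeasure Q],
      P Set.univ ≤ 1 → M ≤ P → M ≤ Q → ∀ B, MeasurableSet B →
      P.real B - Q.real B ≤ 1 - M.real Set.univ := by
    intro P Q _ _ hP hMP hMQ B hB
    have h1 : P.real B + P.real Bᶜ = P.real Set.univ := measureReal_add_measureReal_compl hB
    have h2 : M.real B + M.real Bᶜ = M.real Set.univ := measureReal_add_measureReal_compl hB
    have h3 : P.real Set.univ ≤ 1 := ENNReal.toReal_le_of_le_ofReal zero_le_one (by simpa using hP)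
    have h4 : M.real Bᶜ ≤ P.real Bᶜ := ENNReal.toReal_mono (measure_ne_top _ _) (hMP _)
    have h5 : M.real B ≤ Q.real B := ENNReal.toReal_mono (measure_ne_top _ _) (hMQ _)
    linarith
  have : Nonempty {B : Set (Eu d) // MeasurableSet B} := ⟨⟨∅, .empty⟩⟩
  refine ciSup_le fun B => abs_sub_le_iff.2 ⟨key P Q hP hMP hMQ B.1 B.2, key Q P hQ hMQ hMP B.1 B.2⟩

variable {K : Set (Eu d)} {F s : Eu d → ℝ} {r : ℝ} {p : Eu d}

lemma gaussDensity_nonneg (F : Eu d → ℝ) (r : ℝ) (p z : Eu d) : 0 ≤ gaussDensity F r p z :=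
  div_nonneg (Real.exp_pos _).le (integral_nonneg fun _ => (Real.exp_pos _).le)

lemma acceptProb_nonneg (F s : Eu d → ℝ) (r : ℝ) (p z : Eu d) : 0 ≤ acceptProb F s r p z :=
  le_min zero_le_one (div_nonneg (mul_nonneg (gaussDensity_nonneg F r z p) (Real.exp_pos _).le)
    (mul_nonneg (gaussDensity_nonneg F r p z) (Real.exp_pos _).le))

lemma acceptProb_le_one (F s : Eu d → ℝ) (r : ℝ) (p z : Eu d) : acceptProb F s r p z ≤ 1 :=
  min_le_left _ _

/-- Lower integrals are superadditive, so that the measurability of the acceptance probability,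
which may fail on the boundary of `K`, is not needed for this bound. -/
lemma kernel_univ_le (hK : MeasurableSet K) (hp : proposal F r p Set.univ = 1) :
    kernel K F s r p Set.univ ≤ 1 := by
  have h1 : ∫⁻ z in K, ENNReal.ofReal (acceptProb F s r p z) ∂(proposal F r p) +
      ∫⁻ z in K, ENNReal.ofReal (1 - acceptProb F s r p z) ∂(proposal F r p) ≤
      proposal F r p K := by
    refine (le_lintegral_add _ _).trans_eq ?_
    have : ∀ z, ENNReal.ofReal (acceptProb F s r p z) + ENNReal.ofReal (1 - acceptProb F s r p z)
        = 1 := fun z => by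
      rw [← ENNReal.ofReal_add (acceptProb_nonneg F s r p z)
        (sub_nonneg.2 (acceptProb_le_one F s r p z))]
      simp
    simp [this]
  have h2 : proposal F r p K + proposal F r p Kᶜ = 1 := by rw [measure_add_measure_compl hK, hp]
  simp only [kernel, Measure.add_apply, Measure.smul_apply, measure_univ, smul_eq_mul, mul_one,
    withDensity_apply _ MeasurableSet.univ, Measure.restrict_univ]
  calc _ ≤ (1 / 2 : ℝ≥0∞) + 1 / 2 * (proposal F r p K + proposal F r p Kᶜ) := by
        refine add_le_add le_rfl (mul_le_mul_right ?_ _)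
        rw [add_left_comm, add_comm (proposal F r p K)]
        exact add_le_add le_rfl h1
    _ = 1 := by rw [h2, mul_one]; exact ENNReal.add_halves 1

/-- On a set where proposals are accepted with probability at least `α`, the transition law
dominates `α / 2` times any minorant of the proposal density. -/
lemma le_kernel {A : Set (Eu d)} (hA : MeasurableSet A) (hAK : A ⊆ K) {α : ℝ}
    (hα : ∀ z ∈ A, α ≤ acceptProb F s r p z) {f : Eu d → ℝ}
    (hf : ∀ z ∈ A, f z ≤ gaussDensity F r p z) :
    (1 / 2 * ENNReal.ofReal α) • (volume.restrict A).withDensity (fun z => ENNReal.ofReal (f z)) ≤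
      kernel K F s r p := by
  refine Measure.le_iff.2 fun B hB => ?_
  have h1 : ENNReal.ofReal α * ∫⁻ z in B ∩ A, ENNReal.ofReal (f z) ≤
      ∫⁻ z in B ∩ K, ENNReal.ofReal (acceptProb F s r p z) ∂(proposal F r p) := by
    calc ENNReal.ofReal α * ∫⁻ z in B ∩ A, ENNReal.ofReal (f z)
        ≤ ENNReal.ofReal α * proposal F r p (B ∩ A) := by
          rw [proposal, withDensity_apply _ (hB.inter hA)]
          exact mul_le_mul_right (setLIntegral_mono' (hB.inter hA)
            fun z hz => ENNReal.ofReal_le_ofReal (hf z hz.2)) _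
      _ = ∫⁻ _ in B ∩ A, ENNReal.ofReal α ∂(proposal F r p) := by
          rw [setLIntegral_const]
      _ ≤ ∫⁻ z in B ∩ A, ENNReal.ofReal (acceptProb F s r p z) ∂(proposal F r p) :=
          setLIntegral_mono' (hB.inter hA) fun z hz => ENNReal.ofReal_le_ofReal (hα z hz.2)
      _ ≤ _ := lintegral_mono_set (Set.inter_subset_inter_right B hAK)
  simp only [kernel, Measure.add_apply, Measure.smul_apply, smul_eq_mul, withDensity_apply _ hB,
    Measure.restrict_restrict hB]
  rw [mul_assoc]
  refine le_add_left (mul_le_mul_right (h1.trans le_self_add) _)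

section Density

variable {ν : ℕ} {z : Eu d}

lemma gaussDensity_eq (hF : IsSelfConcordantBarrier K F ν) (hp : p ∈ interior K) (r : ℝ)
    (z : Eu d) : gaussDensity F r p z =
      Real.exp (-(d / r ^ 2 * hessQuad F p (z - p))) / gaussConst F (d / r ^ 2) p := by
  have h : ∀ u, gaussWeight F r p u =
      Real.exp (logVol F p) * Real.exp (-(d / r ^ 2 * hessQuad F p (p - u))) := by
    intro u
    rw [gaussWeight, hF.sq_localNorm hp, ← Real.exp_add]
    ring_nf
  rw [gaussDensity, hessQuad_sub_comm F p z p]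
  simp only [h]
  rw [integral_const_mul, mul_div_mul_left _ _ (Real.exp_pos _).ne', gaussConst,
    integral_sub_left_eq_self (fun u => Real.exp (-(d / r ^ 2 * hessQuad F p u)))]

lemma proposal_univ (hF : IsSelfConcordantBarrier K F ν) (hK : IsCompact K)
    (hp : p ∈ interior K) (hd : 1 ≤ d) (hr : 0 < r) : proposal F r p Set.univ = 1 := by
  have hb : 0 < (d : ℝ) / r ^ 2 := by
    have : (0 : ℝ) < d := by exact_mod_cast hd
    positivity
  have hi := (hF.integrable_gauss hK hp hb).comp_sub_right p
  have e : gaussDensity F r p = fun z =>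
      Real.exp (-(d / r ^ 2 * hessQuad F p (z - p))) / gaussConst F (d / r ^ 2) p :=
    funext (gaussDensity_eq hF hp r)
  rw [proposal, withDensity_apply _ MeasurableSet.univ, Measure.restrict_univ,
    ← ofReal_integral_eq_lintegral_ofReal (by rw [e]; exact hi.div_const _)
    (ae_of_all _ fun z => gaussDensity_nonneg F r p z), e, integral_div,
    integral_sub_right_eq_self (fun u => Real.exp (-(d / r ^ 2 * hessQuad F p u)))]
  change ENNReal.ofReal (gaussConst F _ p / gaussConst F _ p) = 1
  rw [div_self (hF.gaussConst_pos hK hp hb).ne', ENNReal.ofReal_one]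

/-- `p` and `q` have comparable local norms, up to the factor `e^a` for the squares. -/
def HessComparable (F : Eu d → ℝ) (a : ℝ) (p q : Eu d) : Prop :=
  ∀ v, hessQuad F q v ≤ Real.exp a * hessQuad F p v ∧
    hessQuad F p v ≤ Real.exp a * hessQuad F q v

lemma HessComparable.symm {a : ℝ} {q : Eu d} (h : HessComparable F a p q) :
    HessComparable F a q p := fun v => ⟨(h v).2, (h v).1⟩

lemma HessComparable.trans {a a' : ℝ} {q : Eu d} (h : HessComparable F a p q)
    (h' : HessComparable F a' q z) : HessComparable F (a + a') p z := fun v => by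
  rw [Real.exp_add]
  constructor
  · calc hessQuad F z v ≤ Real.exp a' * hessQuad F q v := (h' v).1
      _ ≤ Real.exp a' * (Real.exp a * hessQuad F p v) := by gcongr; exact (h v).1
      _ = _ := by ring
  · calc hessQuad F p v ≤ Real.exp a * hessQuad F q v := (h v).2
      _ ≤ Real.exp a * (Real.exp a' * hessQuad F z v) := by gcongr; exact (h' v).2
      _ = _ := by ring

lemma exp_sub_one_le_mul_exp (a : ℝ) : Real.exp a - 1 ≤ a * Real.exp a := by
  have h := Real.add_one_le_exp (-a)
  have h2 := mul_le_mul_of_nonneg_right h (Real.exp_pos a).le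
  rw [← Real.exp_add, neg_add_cancel, Real.exp_zero] at h2
  linarith

/-- Changing the centre of the Hessian within a comparable pair changes the Gaussian exponent of a
displacement `v` with `‖v‖_p² ≤ D r²` by at most a constant, as soon as `a d` is bounded. -/
lemma HessComparable.mul_hessQuad_le (hF : IsSelfConcordantBarrier K F ν) (hp : p ∈ interior K)
    {a A D : ℝ} {q v : Eu d} (h : HessComparable F a p q) (hr : 0 < r) (ha : 0 ≤ a)
    (had : a * d ≤ A) (hd : 1 ≤ d) (hv : hessQuad F p v ≤ D * r ^ 2) :
    d / r ^ 2 * hessQuad F q v ≤ d / r ^ 2 * hessQuad F p v + A * Real.exp A * D := by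
  have hd' : (1 : ℝ) ≤ d := by exact_mod_cast hd
  have haA : a ≤ A := by nlinarith
  have hq := hF.hessQuad_nonneg hp v
  have hD : 0 ≤ D := by
    by_contra hneg
    have : D * r ^ 2 < 0 := mul_neg_of_neg_of_pos (not_le.1 hneg) (by positivity)
    linarith
  have h1 : hessQuad F q v - hessQuad F p v ≤ a * Real.exp A * (D * r ^ 2) := by
    calc hessQuad F q v - hessQuad F p v ≤ (Real.exp a - 1) * hessQuad F p v := by
          linarith [(h v).1]
      _ ≤ (a * Real.exp a) * hessQuad F p v := by gcongr; exact exp_sub_one_le_mul_exp a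
      _ ≤ _ := by gcongr
  have h2 : d / r ^ 2 * (hessQuad F q v - hessQuad F p v) ≤
      d / r ^ 2 * (a * Real.exp A * (D * r ^ 2)) := by gcongr
  have h3 : d / r ^ 2 * (a * Real.exp A * (D * r ^ 2)) = (a * d) * Real.exp A * D := by
    field_simp
  have h4 : (a * d) * Real.exp A * D ≤ A * Real.exp A * D := by gcongr
  rw [mul_sub] at h2
  linarith

/-- The acceptance probability from `p` of a point `z` at local distance `O(r)`, at which the
local norm is comparable with the one at `p` and the function `s` is not much larger. -/
lemma le_acceptProb (hF : IsSelfConcordantBarrier K F ν) (hK : IsCompact K) (hp : p ∈ interior K)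
    (hz : z ∈ interior K) {a A D S : ℝ} (h : HessComparable F a p z) (hr : 0 < r) (ha : 0 ≤ a)
    (had : a * d ≤ A) (hd : 1 ≤ d) (hv : hessQuad F p (z - p) ≤ D * r ^ 2) (hD : 0 ≤ D)
    (hS : 0 ≤ S) (hs : s z - s p ≤ S) :
    Real.exp (-(A / 2 + A * Real.exp A * D + S)) ≤ acceptProb F s r p z := by
  have hb : 0 < (d : ℝ) / r ^ 2 := by
    have : (0 : ℝ) < d := by exact_mod_cast hd
    positivity
  have hA : 0 ≤ A := (mul_nonneg ha (Nat.cast_nonneg d)).trans had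
  have hZp := hF.gaussConst_pos hK hp hb
  have hZz := hF.gaussConst_pos hK hz hb
  refine le_min (Real.exp_le_one_iff.2 (by
    have : 0 ≤ A * Real.exp A * D := by positivity
    linarith)) ?_
  rw [gaussDensity_eq hF hp, gaussDensity_eq hF hz, hessQuad_sub_comm F z p z]
  have hZ := hF.exp_mul_gaussConst_le hK hz hp hb fun v => (h v).2
  have hQ := h.mul_hessQuad_le hF hp hr ha had hd hv
  rw [le_div_iff₀ (by positivity)]
  set b : ℝ := d / r ^ 2
  set q := hessQuad F p (z - p)
  set q' := hessQuad F z (z - p)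
  set T := A * Real.exp A * D
  have e1 : Real.exp (-(A / 2 + T + S)) * (Real.exp (-(b * q)) / gaussConst F b p *
      Real.exp (s z)) = Real.exp (-(A / 2 + T + S) + -(b * q) + s z) / gaussConst F b p := by
    rw [Real.exp_add, Real.exp_add]; ring
  have e2 : Real.exp (-(b * q')) / gaussConst F b z * Real.exp (s p) =
      Real.exp (-(b * q') + s p) / gaussConst F b z := by
    rw [Real.exp_add]; ring
  rw [e1, e2, div_le_div_iff₀ hZp hZz]
  calc Real.exp (-(A / 2 + T + S) + -(b * q) + s z) * gaussConst F b z
      ≤ Real.exp (-(b * q') + s p + -(a * d / 2)) * gaussConst F b z := by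
        refine mul_le_mul_of_nonneg_right (Real.exp_le_exp.2 ?_) hZz.le
        linarith
    _ = Real.exp (-(b * q') + s p) * (Real.exp (-(a * d / 2)) * gaussConst F b z) := by
        rw [Real.exp_add _ (-(a * d / 2))]; ring
    _ ≤ _ := by gcongr

end Density

end Transition

/-! ### Overlap of the transition laws at nearby points -/

section Overlap

variable {K : Set (Eu d)} {F s : Eu d → ℝ} {ν : ℕ} {r : ℝ} {x y g : Eu d}

lemma IsInteriorPath.hessComparable {γ γ' : ℝ → Eu d} (hγ : IsInteriorPath K γ γ')
    (hF : IsSelfConcordantBarrier K F ν) {L : ℝ} (hL : arcLength F γ γ' 1 ≤ L) :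
    HessComparable F (6 * L) (γ 0) (γ 1) := by
  have m0 : (0 : ℝ) ∈ Set.Icc (0 : ℝ) 1 := Set.left_mem_Icc.2 zero_le_one
  have m1 : (1 : ℝ) ∈ Set.Icc (0 : ℝ) 1 := Set.right_mem_Icc.2 zero_le_one
  intro v
  have q0 := hF.hessQuad_nonneg (hγ.mem 0 m0) v
  have q1 := hF.hessQuad_nonneg (hγ.mem 1 m1) v
  exact ⟨(hγ.hessQuad_le hF m0 m1 v).trans (by gcongr),
    (hγ.hessQuad_le hF m1 m0 v).trans (by gcongr)⟩

lemma IsInteriorPath.hessQuad_sub_le {γ γ' : ℝ → Eu d} (hγ : IsInteriorPath K γ γ')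
    (hF : IsSelfConcordantBarrier K F ν) {L τ : ℝ} (hL : arcLength F γ γ' 1 ≤ L)
    (hτ : τ ∈ Set.Icc (0 : ℝ) 1) :
    hessQuad F (γ τ) (γ 1 - γ 0) ≤ Real.exp (6 * L) * L ^ 2 := by
  have m0 : (0 : ℝ) ∈ Set.Icc (0 : ℝ) 1 := Set.left_mem_Icc.2 zero_le_one
  have m1 : (1 : ℝ) ∈ Set.Icc (0 : ℝ) 1 := Set.right_mem_Icc.2 zero_le_one
  have h := hγ.localNorm_sub_le hF m0 m1 zero_le_one hτ
  rw [arcLength_zero, sub_zero] at h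
  have h0 := hγ.arcLength_nonneg hF m1
  have h1 : localNorm F (γ τ) (γ 1 - γ 0) ≤ Real.exp (3 * L) * L :=
    h.trans (by gcongr)
  have h2 := pow_le_pow_left₀ (localNorm_nonneg F _ _) h1 2
  rw [hF.sq_localNorm (hγ.mem τ hτ), mul_pow, ← Real.exp_nat_mul] at h2
  refine h2.trans_eq ?_
  push_cast; ring_nf

/-- Along a path of length `O(r)`, the deviation of `s` from linearity is bounded by a constant. -/
lemma IsInteriorPath.abs_sub_inner_le_of_arcLength_le {γ γ' : ℝ → Eu d}
    (hγ : IsInteriorPath K γ γ') (hF : IsSelfConcordantBarrier K F ν) {c₀ c₁ E l : ℝ} {n : ℕ}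
    (hc₁ : 0 < c₁) (hr : 0 < r)
    (hs : ∀ z ∈ interior K, ∀ w ∈ K, localNorm F z (z - w) < c₁ * r →
      |s z - s w - inner ℝ g (z - w)| < c₀)
    (hE : Real.exp (3 * arcLength F γ γ' 1) ≤ E) (hl : arcLength F γ γ' 1 ≤ l * r)
    (hn : 2 * E * l ≤ n * c₁) :
    |s (γ 1) - s (γ 0) - inner ℝ g (γ 1 - γ 0)| ≤ (n + 1) * c₀ := by
  have hE0 : 0 < E := (Real.exp_pos _).trans_le hE
  refine hγ.abs_sub_inner_le hF (ε := c₁ * r / (2 * E)) (by positivity) hs ?_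
    (Set.right_mem_Icc.2 zero_le_one) ?_
  · calc Real.exp (3 * arcLength F γ γ' 1) * (c₁ * r / (2 * E)) ≤ E * (c₁ * r / (2 * E)) := by
          gcongr
      _ = c₁ * r / 2 := by field_simp
      _ < c₁ * r := half_lt_self (by positivity)
  · refine hl.trans ?_
    rw [mul_div_assoc', le_div_iff₀ (by positivity)]
    nlinarith [mul_le_mul_of_nonneg_right hn hr.le]

/-- The part of the step size condition which concerns `s`, at radii strictly below `r`. -/
lemma exists_slope_of_isValidStepSize {c₀ c₁ : ℝ} (hc₁ : 0 < c₁)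
    (h : IsValidStepSize K F s c₀ c₁ r) :
    ∃ g : Eu d, ∀ z ∈ interior K, ∀ w ∈ K, localNorm F z (z - w) < c₁ * r →
      |s z - s w - inner ℝ g (z - w)| < c₀ := by
  obtain ⟨-, rstar, hr, g, hg⟩ := h
  refine ⟨g, fun z hz w hw hzw => ?_⟩
  have h1 : localNorm F z (z - w) / c₁ < r := by rwa [div_lt_iff₀' hc₁]
  have h2 : ((localNorm F z (z - w) / c₁ : ℝ) : EReal) <
      ⨆ t ∈ goodRadii K F s c₀ c₁ g, (t : EReal) :=
    (EReal.coe_lt_coe_iff.2 (h1.trans_le (hr.trans (min_le_right _ _)))).trans_le hg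
  simp only [lt_iSup_iff] at h2
  obtain ⟨t, ht, hlt⟩ := h2
  refine ht z hz w hw ?_
  rw [EReal.coe_lt_coe_iff, div_lt_iff₀' hc₁] at hlt
  exact hlt.le

/-- The factor by which the good set is shrunk, so that it lies in the Dikin ellipsoid. -/
def shrink (d : ℕ) : ℝ := min 1 (d / 8)

lemma exp_neg_eight_le_shrink_pow (hd : 1 ≤ d) : Real.exp (-8) ≤ shrink d ^ d := by
  have hd' : (0 : ℝ) < d := by exact_mod_cast hd
  have key : Real.exp (-(8 / d)) ≤ shrink d := by
    refine le_min (Real.exp_le_one_iff.2 (by rw [neg_nonpos]; positivity)) ?_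
    have h := Real.add_one_le_exp (8 / (d : ℝ))
    rw [Real.exp_neg, inv_le_comm₀ (Real.exp_pos _) (by positivity), inv_div]
    linarith
  have h := pow_le_pow_left₀ (Real.exp_pos _).le key d
  rw [← Real.exp_nat_mul] at h
  have e : (d : ℝ) * -(8 / d) = -8 := by field_simp
  rwa [e] at h

/-- A lower bound for the common mass of the transition laws at two points, in terms of bounds `α`
for the logarithmic variation of the Hessian (times the dimension), `β` for the Gaussian exponent
of the displacement and `S` for the deviation of `s` from linearity. -/
def overlapConst (α β S : ℝ) : ℝ :=
  Real.exp (-((α + 24) / 2 + (α + 24) * Real.exp (α + 24) * (Real.exp α * (8 + 2 * β)) + 2 * S)) *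
    Real.exp (-((α + 24) / 2 + (α + 24) * Real.exp (α + 24) * (Real.exp α * (8 + 2 * β)) +
      (2 * β + 3))) * (Real.exp (-8) / 8)

/-- If the linear part of `s` is not larger at `x` than at `y`, then proposals in the good set around
`x` are accepted from both points with probability bounded below, and the proposal density at `y` is
at least a multiple of the one at `x` there. -/
lemma tvDist_kernel_le_of_inner_nonneg (hF : IsSelfConcordantBarrier K F ν) (hK : IsCompact K)
    (hd : 1 ≤ d) (hr : 0 < r) (hrd : r ≤ 1 / d) (hx : x ∈ interior K) (hy : y ∈ interior K)
    {a α β S : ℝ} (ha : 0 ≤ a) (had : a * d ≤ α) (hxy : HessComparable F a x y)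
    (hw : d / r ^ 2 * hessQuad F x (y - x) ≤ β)
    (hsy : |s y - s x - inner ℝ g (y - x)| ≤ S) (hg : 0 ≤ inner ℝ g (y - x))
    (hsz : ∀ v, hessQuad F x v ≤ 4 * r ^ 2 → hessQuad F x v < 1 / 4 →
      |s (x + v) - s x - inner ℝ g v| ≤ S) :
    tvDist (kernel K F s r x) (kernel K F s r y) ≤ 1 - overlapConst α β S := by
  have hd1 : (1 : ℝ) ≤ d := by exact_mod_cast hd
  have hd0 : (0 : ℝ) < d := by linarith
  have hrd1 : r * d ≤ 1 := by rwa [le_div_iff₀ hd0] at hrd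
  have hb : 0 < (d : ℝ) / r ^ 2 := by positivity
  have hα : 0 ≤ α := (by positivity : 0 ≤ a * d).trans had
  have haα : a ≤ α := by nlinarith
  have hqw := hF.hessQuad_nonneg hx (y - x)
  have hβ : 0 ≤ β := (by positivity : 0 ≤ d / r ^ 2 * hessQuad F x (y - x)).trans hw
  have hS : 0 ≤ S := (abs_nonneg _).trans hsy
  have hqw' : hessQuad F x (y - x) ≤ β * r ^ 2 := by
    have : 1 / r ^ 2 * hessQuad F x (y - x) ≤ β := le_trans (by gcongr) hw
    rwa [one_div_mul_eq_div, div_le_iff₀ (by positivity)] at this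
  set θ := shrink d with hθ
  have hθ0 : 0 < θ := lt_min one_pos (by positivity)
  have hθ1 : θ ≤ 1 := min_le_left _ _
  have hθd : θ ≤ d / 8 := min_le_right _ _
  set G := goodSet F (d / r ^ 2) θ x (y - x) g with hG
  set A := (fun z => z - x) ⁻¹' G with hA
  have hAm : MeasurableSet A := (measurable_id.sub_const x) (measurableSet_goodSet _ _ _ _ _ _)
  set α' := α + 24 with hα'
  set D := Real.exp α * (8 + 2 * β) with hD
  have hD8 : 8 + 2 * β ≤ D := le_mul_of_one_le_left (by positivity) (Real.one_le_exp hα)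
  set T := α' * Real.exp α' * D with hT
  have hGq : ∀ z ∈ A, hessQuad F x (z - x) ≤ 4 * r ^ 2 ∧ hessQuad F x (z - x) < 1 / 4 := by
    intro z hz
    have h1 : d / r ^ 2 * hessQuad F x (z - x) ≤ 4 * d * θ ^ 2 := hz.1
    have h2 : hessQuad F x (z - x) ≤ 4 * (θ * r) ^ 2 := by
      rw [div_mul_eq_mul_div, div_le_iff₀ (by positivity)] at h1
      refine le_of_mul_le_mul_left ?_ hd0
      linarith
    have h3 : (θ * r) ^ 2 ≤ (1 * r) ^ 2 := by gcongr
    have h4 : θ * r ≤ 1 / 8 := by nlinarith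
    have h5 : (θ * r) ^ 2 ≤ (1 / 8) ^ 2 := by gcongr
    constructor <;> linarith
  have hnear : ∀ z ∈ A, z ∈ interior K ∧ HessComparable F (6 * (4 * r)) x z := by
    intro z hz
    obtain ⟨h1, h2⟩ := hGq z hz
    obtain ⟨hγ, hlen⟩ := hF.isInteriorPath_segment hx h2
    have hn : localNorm F x (z - x) ≤ 2 * r := by
      apply Real.sqrt_le_iff.2 ⟨by positivity, _⟩
      change hessQuad F x (z - x) ≤ _
      linarith
    have hc := hγ.hessComparable hF (L := 4 * r) (by linarith)
    have hm := hγ.mem 1 (Set.right_mem_Icc.2 zero_le_one)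
    simp only [zero_smul, add_zero, one_smul, add_sub_cancel] at hc hm
    exact ⟨hm, hc⟩
  have hszA : ∀ z ∈ A, s z - s x ≤ S ∧ s z - s y ≤ 2 * S := by
    intro z hz
    have h1 := hsz (z - x) (hGq z hz).1 (hGq z hz).2
    rw [add_sub_cancel] at h1
    have h2 : inner ℝ g (z - x) ≤ 0 := hz.2.2
    have h3 := (abs_le.1 h1).2
    have h4 := (abs_le.1 hsy).1
    constructor <;> linarith
  have hQxy : ∀ z ∈ A, hessQuad F x (z - y) ≤ (8 + 2 * β) * r ^ 2 := by
    intro z hz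
    have h1 := hF.hessQuad_sub_le hx (z - x) (y - x)
    rw [sub_sub_sub_cancel_right] at h1
    linarith [(hGq z hz).1]
  have hDr : (8 + 2 * β) * r ^ 2 ≤ D * r ^ 2 := by gcongr
  have haccx : ∀ z ∈ A, Real.exp (-(α' / 2 + T + 2 * S)) ≤ acceptProb F s r x z := by
    intro z hz
    refine le_acceptProb hF hK hx (hnear z hz).1 (hnear z hz).2 hr (by positivity) (by linarith)
      hd ?_ (by positivity) (by positivity) (by linarith [(hszA z hz).1])
    refine ((hGq z hz).1.trans ?_).trans hDr
    gcongr; linarith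
  have haccy : ∀ z ∈ A, Real.exp (-(α' / 2 + T + 2 * S)) ≤ acceptProb F s r y z := by
    intro z hz
    refine le_acceptProb hF hK hy (hnear z hz).1 (hxy.symm.trans (hnear z hz).2) hr
      (by positivity) (by linarith) hd ?_ (by positivity) (by positivity) (hszA z hz).2
    calc hessQuad F y (z - y) ≤ Real.exp a * hessQuad F x (z - y) := (hxy _).1
      _ ≤ Real.exp α * ((8 + 2 * β) * r ^ 2) :=
          mul_le_mul (Real.exp_le_exp.2 haα) (hQxy z hz) (hF.hessQuad_nonneg hx _)
            (Real.exp_pos _).le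
      _ = D * r ^ 2 := by rw [hD]; ring
  set κ := Real.exp (-(α' / 2 + T + (2 * β + 3))) with hκ
  have hκ1 : κ ≤ 1 := Real.exp_le_one_iff.2 (by
    have : 0 ≤ T := by positivity
    linarith)
  have hZx := hF.gaussConst_pos hK hx hb
  have hZy := hF.gaussConst_pos hK hy hb
  have hfx : ∀ z ∈ A, κ * gaussDensity F r x z ≤ gaussDensity F r x z := fun z _ =>
    mul_le_of_le_one_left (gaussDensity_nonneg F r x z) hκ1
  have hfy : ∀ z ∈ A, κ * gaussDensity F r x z ≤ gaussDensity F r y z := by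
    intro z hz
    rw [gaussDensity_eq hF hx, gaussDensity_eq hF hy, mul_div_assoc', hκ, ← Real.exp_add,
      div_le_div_iff₀ hZx hZy]
    have hZ := hF.exp_mul_gaussConst_le hK hy hx hb fun v => (hxy v).2
    have h1 := hxy.mul_hessQuad_le hF hx hr ha (had.trans (by linarith : α ≤ α')) hd
      ((hQxy z hz).trans hDr)
    have h2 := hF.hessQuad_sub hx (z - x) (y - x)
    rw [sub_sub_sub_cancel_right] at h2
    have h3 : -(2 * (d / r ^ 2) * hessForm F x (z - x) (y - x)) ≤
      d / r ^ 2 * hessQuad F x (y - x) + 3 := hz.2.1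
    rw [h2] at h1
    calc _ ≤ Real.exp (-(d / r ^ 2 * hessQuad F y (z - y)) + -(a * d / 2)) *
          gaussConst F (d / r ^ 2) y := by
          refine mul_le_mul_of_nonneg_right (Real.exp_le_exp.2 ?_) hZy.le
          linarith
      _ = Real.exp (-(d / r ^ 2 * hessQuad F y (z - y))) *
          (Real.exp (-(a * d / 2)) * gaussConst F (d / r ^ 2) y) := by rw [Real.exp_add]; ring
      _ ≤ _ := by gcongr
  have hAK : A ⊆ K := fun z hz => interior_subset (hnear z hz).1
  refine (tvDist_le_of_le
    (kernel_univ_le hK.measurableSet (proposal_univ hF hK hx hd hr))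
    (kernel_univ_le hK.measurableSet (proposal_univ hF hK hy hd hr))
    (le_kernel hAm hAK haccx hfx) (le_kernel hAm hAK haccy hfy)).trans ?_
  rw [sub_le_sub_iff_left]
  set e : Eu d → ℝ := fun v => Real.exp (-(d / r ^ 2 * hessQuad F x v)) with he
  have hie : Integrable e := hF.integrable_gauss hK hx hb
  have hmass : θ ^ d / 4 * gaussConst F (d / r ^ 2) x ≤ ∫ z in A, e (z - x) := by
    have h1 := hF.le_setIntegral_goodSet hK hx hb hd (y - x) g hθ0 hθ1
    refine h1.trans_eq ?_
    rw [← integral_indicator (measurableSet_goodSet _ _ _ _ _ _), ← integral_indicator hAm,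
      ← integral_sub_right_eq_self _ x]
    rfl
  have hdens : (fun z => κ * gaussDensity F r x z) =
      fun z => κ / gaussConst F (d / r ^ 2) x * e (z - x) := by
    funext z
    rw [gaussDensity_eq hF hx]; ring
  rw [measureReal_def, Measure.smul_apply, withDensity_apply _ MeasurableSet.univ,
    Measure.restrict_univ, ← ofReal_integral_eq_lintegral_ofReal
      (by rw [hdens]; exact ((hie.comp_sub_right x).const_mul _).integrableOn)
      (ae_of_all _ fun z => mul_nonneg (Real.exp_pos _).le (gaussDensity_nonneg F r x z)),
    hdens, integral_const_mul, smul_eq_mul, ENNReal.toReal_mul, ENNReal.toReal_mul,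
    ENNReal.toReal_ofReal (Real.exp_pos _).le, ENNReal.toReal_ofReal (mul_nonneg
      (div_nonneg (Real.exp_pos _).le hZx.le) (integral_nonneg fun _ => (Real.exp_pos _).le))]
  have h8 := exp_neg_eight_le_shrink_pow hd
  have hfin : κ * (Real.exp (-8) / 4) ≤
      κ / gaussConst F (d / r ^ 2) x * ∫ z in A, e (z - x) := by
    rw [div_mul_eq_mul_div, le_div_iff₀ hZx, mul_assoc]
    refine mul_le_mul_of_nonneg_left (le_trans ?_ hmass) (Real.exp_pos _).le
    gcongr
  have hhalf : ((1 / 2 : ℝ≥0∞)).toReal = 1 / 2 := by simp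
  rw [hhalf]
  calc overlapConst α β S
      = 1 / 2 * Real.exp (-(α' / 2 + T + 2 * S)) * (κ * (Real.exp (-8) / 4)) := by
        rw [overlapConst, hκ]; ring
    _ ≤ _ := by gcongr

end Overlap

end DikinWalk

end

open DikinWalk in
theorem lemma3p2 (c₀ c₁ C : ℝ) (hc₀ : 0 < c₀) (hc₁ : 0 < c₁) (hC : 0 < C) :
    ∃ C' : ℝ, 0 < C' ∧
      ∀ (d : ℕ), 1 ≤ d →
      ∀ (K : Set (DikinWalk.Eu d)), IsCompact K → Convex ℝ K → (interior K).Nonempty →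
      ∀ (F : DikinWalk.Eu d → ℝ) (ν : ℕ), DikinWalk.IsSelfConcordantBarrier K F ν →
      ∀ (s : DikinWalk.Eu d → ℝ), ConvexOn ℝ K s →
      ∀ (r : ℝ), DikinWalk.IsValidStepSize K F s c₀ c₁ r →
      ∀ x ∈ K, ∀ y ∈ K,
        DikinWalk.riemDist K F x y ≤ ENNReal.ofReal (r / (C * Real.sqrt d)) →
        DikinWalk.tvDist (DikinWalk.kernel K F s r x) (DikinWalk.kernel K F s r y)
          ≤ 1 - 1 / C' := by
  set α := 12 / C with hα
  set β := Real.exp α * (4 / C ^ 2) with hβ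
  set E := Real.exp (α + 12) with hE
  set l := 2 / C + 4 with hl
  obtain ⟨n, hn⟩ := exists_nat_ge (2 * E * l / c₁)
  rw [div_le_iff₀ hc₁] at hn
  set S := ((n : ℝ) + 1) * c₀ with hS
  have hpos : 0 < overlapConst α β S := by unfold overlapConst; positivity
  refine ⟨1 / overlapConst α β S, by positivity, ?_⟩
  intro d hd K hK _ _ F ν hF s _ r hr x _ y _ hxy
  rw [one_div_one_div]
  obtain ⟨g, hg⟩ := exists_slope_of_isValidStepSize hc₁ hr
  obtain ⟨hr0, rstar, hrle, -⟩ := hr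
  have hrd : r ≤ 1 / d := hrle.trans (min_le_left _ _)
  have hd1 : (1 : ℝ) ≤ d := by exact_mod_cast hd
  have hd0 : (0 : ℝ) < d := by linarith
  have hsd : 1 ≤ √(d : ℝ) := Real.one_le_sqrt.2 hd1
  have hsd2 : √(d : ℝ) ^ 2 = d := Real.sq_sqrt hd0.le
  have hrd1 : r * d ≤ 1 := by rwa [le_div_iff₀ hd0] at hrd
  have hr1 : r ≤ 1 := by nlinarith
  -- The infimum in the distance need not be attained, hence the factor `2`.
  set δ := r / (C * √(d : ℝ)) with hδ
  have hδ0 : 0 < δ := by positivity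
  set L := 2 * δ with hL
  obtain ⟨γ, γ', hγ, h0, h1, hlen⟩ := exists_isInteriorPath_of_riemDist_lt (δ := L) hF
    (hxy.trans_lt ((ENNReal.ofReal_lt_ofReal_iff (by positivity)).2 (by linarith)))
  have hLl : L ≤ 2 / C * r := by
    have : δ ≤ r / C := by
      apply div_le_div_of_nonneg_left hr0.le hC
      exact le_mul_of_one_le_right hC.le hsd
    calc L ≤ 2 * (r / C) := by rw [hL]; gcongr
      _ = 2 / C * r := by ring
  have hLd : 6 * L * d ≤ α := by
    calc 6 * L * d ≤ 6 * (2 / C * r) * d := by gcongr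
      _ = α * (r * d) := by rw [hα]; ring
      _ ≤ α * 1 := by gcongr
      _ = α := mul_one _
  have hLα : 6 * L ≤ α := by
    have : 0 < 6 * L := by positivity
    nlinarith
  have hLβ : d / r ^ 2 * (Real.exp (6 * L) * L ^ 2) ≤ β := by
    have h : d / r ^ 2 * L ^ 2 = 4 / C ^ 2 := by
      rw [hL, hδ, mul_pow, div_pow, mul_pow, hsd2]; field_simp; norm_num
    calc d / r ^ 2 * (Real.exp (6 * L) * L ^ 2) = Real.exp (6 * L) * (d / r ^ 2 * L ^ 2) := by ring
      _ ≤ β := by rw [h, hβ]; gcongr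
  have m0 : (0 : ℝ) ∈ Set.Icc (0 : ℝ) 1 := Set.left_mem_Icc.2 zero_le_one
  have m1 : (1 : ℝ) ∈ Set.Icc (0 : ℝ) 1 := Set.right_mem_Icc.2 zero_le_one
  have hx : x ∈ interior K := h0 ▸ hγ.mem 0 m0
  have hy : y ∈ interior K := h1 ▸ hγ.mem 1 m1
  have hcomp : HessComparable F (6 * L) x y := by
    have := hγ.hessComparable hF hlen.le
    rwa [h0, h1] at this
  have hQ : ∀ τ ∈ Set.Icc (0 : ℝ) 1, d / r ^ 2 * hessQuad F (γ τ) (y - x) ≤ β := by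
    intro τ hτ
    refine le_trans ?_ hLβ
    have := hγ.hessQuad_sub_le hF hlen.le hτ
    rw [h0, h1] at this
    gcongr
  have hsxy : |s y - s x - inner ℝ g (y - x)| ≤ S := by
    have := hγ.abs_sub_inner_le_of_arcLength_le hF (E := E) (l := l) (n := n) hc₁ hr0 hg
      (Real.exp_le_exp.2 (by linarith)) (hlen.le.trans (hLl.trans (by gcongr; linarith))) hn
    rwa [h0, h1] at this
  have hsz : ∀ p ∈ interior K, ∀ v, hessQuad F p v ≤ 4 * r ^ 2 → hessQuad F p v < 1 / 4 →
      |s (p + v) - s p - inner ℝ g v| ≤ S := by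
    intro p hp v hv hv'
    obtain ⟨hσ, hσl⟩ := hF.isInteriorPath_segment hp hv'
    have hnv : localNorm F p v ≤ 2 * r := by
      apply Real.sqrt_le_iff.2 ⟨by positivity, _⟩
      change hessQuad F p v ≤ _
      linarith
    have hC2 : 0 < 2 / C := by positivity
    have := hσ.abs_sub_inner_le_of_arcLength_le hF (E := E) (l := l) (n := n) hc₁ hr0 hg
      (Real.exp_le_exp.2 (by
        have : 0 < α := by positivity
        linarith)) (by rw [hl]; nlinarith) hn
    simpa using this
  -- The good set is placed around the point at which the linear part of `s` is smaller, so that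
  -- one half-space serves both points.
  rcases le_total 0 (inner ℝ g (y - x)) with hgxy | hgxy
  · exact tvDist_kernel_le_of_inner_nonneg hF hK hd hr0 hrd hx hy (by positivity) hLd hcomp
      (h0 ▸ hQ 0 m0) hsxy hgxy (hsz x hx)
  · have hcomm : tvDist (kernel K F s r x) (kernel K F s r y) =
        tvDist (kernel K F s r y) (kernel K F s r x) := by
      simp only [tvDist, abs_sub_comm]
    rw [hcomm]
    refine tvDist_kernel_le_of_inner_nonneg hF hK hd hr0 hrd hy hx (by positivity) hLd hcomp.symm
      ?_ ?_ ?_ (hsz y hy)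
    · rw [hessQuad_sub_comm]
      exact h1 ▸ hQ 1 m1
    · rw [abs_sub_comm] at hsxy
      convert hsxy using 2
      rw [← neg_sub y x, inner_neg_right]; ring
    · rw [← neg_sub y x, inner_neg_right]; linarith
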